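/- Setting. Let $N_A,N_B,N_E,N,K\ge 1$ and $N_{J,1},\dots,N_{J,N}$ be integers with $N_A\le N_B$, $N_A\le N_E$, $N_{J,j}>N_B$ for all $j$, and $N_E<N_J:=\sum_j N_{J,j}$. Let $M$ be a perfect square, $\mathcal Q=\{a+b\,\mathrm{i}: a,b\in\{0,\dots,\sqrt M-1\}\}$, and $P_J>0$. For channel uses $i=1,\dots,K$ let $\mathbf u_i$ be uniform on $\mathcal Q^{N_A}$, let $\mathbf G_i\in\mathbb C^{N_E\times N_A}$, $\hat{\mathbf H}_{JE,i}\in\mathbb C^{N_E\times N_J}$ and $\mathbf H_{JB,i,j}\in\mathbb C^{N_B\times N_{J,j}}$ ($1\le j\le N$) have i.i.d. $\mathcal N_{\mathbb C}(0,1)$ entries, let the columns of $\mathbf Z_{i,j}\in\mathbb C^{N_{J,j}\times(N_{J,j}-N_B)}$ form an orthonormal basis of the null space of $\mathbf H_{JB,i,j}$ almost surely, put $\hat{\mathbf Z}_i=\mathrm{diag}(\mathbf Z_{i,1},\dots,\mathbf Z_{i,N})$, and let $\hat{\mathbf v}_i\in\mathbb C^{N_J-N N_B}$ be a random vector with an arbitrary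 law and with $\|\hat{\mathbf v}_i\|^2\le P_J$ almost surely. All of $\mathbf u_i$, $\mathbf G_i$, $\hat{\mathbf H}_{JE,i}$, $(\mathbf H_{JB,i,j},\mathbf Z_{i,j})$, $\hat{\mathbf v}_i$, over all $i$ and $j$, are mutually independent. Eve observes $\mathbf y_i=\mathbf G_i\mathbf u_i+\hat{\mathbf H}_{JE,i}\hat{\mathbf Z}_i\hat{\mathbf v}_i$. Let $$R_{\max,i}=\max_{\|\mathbf x\|^2\le P_J}\|\hat{\mathbf H}_{JE,i}\hat{\mathbf Z}_i\mathbf x\|,\qquad L_i=\big|\{\mathbf G_i\mathbf q:\mathbf q\in\mathcal Q^{N_A}\}\cap\{\mathbf z\in\mathbb C^{N_E}:\|\mathbf z-\mathbf y_i\|\le R_{\max,i}\}\big|,$$ and $P_{out}(d,K)=1-\Pr\{L_1\ge d,\dots,L_K\ge d\}$. Let $\mathcal U_i=\{\mathbf q\in\mathcal Q^{N_A}:\|\mathbf G_i\mathbf q-\mathbf y_i\|\le R_{\max,i}\}$ be the set of inputs that are compatible with Eve's observation; her posterior given $\mathbf y_i$ is the uniform law on $\mathcal Q^{N_A}$ conditioned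 on $\mathcal U_i$, and her posterior given $\mathbf y_1,\dots,\mathbf y_K$ is the uniform law on $(\mathcal Q^{N_A})^K$ conditioned on $\mathcal U_1\times\dots\times\mathcal U_K$. Ideal secrecy is the event that for every $i$ we have $L_i\ge2$ and $\Pr(\mathbf u_i=\mathbf q\mid\mathbf y_1,\dots,\mathbf y_K)=\Pr(\mathbf u_i=\mathbf q\mid\mathbf y_i)=1/L_i$ for every $\mathbf q\in\mathcal U_i$, in the sense of these posteriors. Theorem. Put $N_{\min}=\min\{N_E-N_A+1,N_A\}$, $\kappa(d)=d^{1/(2N_E)}/\sqrt\pi$ and $\Phi=[(N_E-N_A)!/N_E!]^{1/(2N_A)}$. For every integer $d\ge2$ there is a constant $C$, depending only on $d$, $K$ and the numbers of antennas and of jammers, such that for every $\varepsilon\in(0,1)$, every perfect square $M\ge\varepsilon^{-3-2/N_{\min}}\kappa(d)^2$, $P_J=\varepsilon^{-2/N_{\min}}\kappa(d)^2/\Phi^{2N_A/N_E}$, and all laws of the $\hat{\mathbf v}_i$ as above, $$P_{out}(d,K)\le C\varepsilon ,$$ and ideal secrecy holds with probability at least $1-C\varepsilon$. -/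

import Mathlib

open MeasureTheory ProbabilityTheory

namespace USK

noncomputable section

/-- The circularly symmetric complex Gaussian law with mean `0` and variance `1`: real and
imaginary parts are independent real Gaussians of mean `0` and variance `1 / 2`. -/
def complexGaussian : Measure ℂ :=
  ((gaussianReal 0 (1 / 2)).prod (gaussianReal 0 (1 / 2))).map Complex.equivRealProd.symm

/-- The law of a random `m × n` matrix (as a function of its two indices) with i.i.d. entries
of law `complexGaussian`. -/
def gaussianMatrix (m n : Type*) [Fintype m] [Fintype n] : Measure (m → n → ℂ) :=
  Measure.pi fun _ => Measure.pi fun _ => complexGaussian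

/-- The `M`-QAM alphabet (for a perfect square `M`): real and imaginary parts range over
`{0, 1, ..., √M - 1}`. -/
def qam (M : ℕ) : Set ℂ :=
  {z | ∃ a b : ℕ, a < M.sqrt ∧ b < M.sqrt ∧ z = (a : ℂ) + (b : ℂ) * Complex.I}

/-- The constellation of transmitted vectors: `NA`-tuples of `M`-QAM symbols. -/
def constellation (NA M : ℕ) : Set (Fin NA → ℂ) :=
  {q | ∀ a, q a ∈ qam M}

/-- Indices of all the jammers' antennas; jammer `j` has `NJ j` antennas. -/
abbrev JamAntenna {N : ℕ} (NJ : Fin N → ℕ) : Type :=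
  Σ j : Fin N, Fin (NJ j)

/-- Indices of the coordinates of the one-time pad; jammer `j` contributes `NJ j - NB`. -/
abbrev PadIndex {N : ℕ} (NB : ℕ) (NJ : Fin N → ℕ) : Type :=
  Σ j : Fin N, Fin (NJ j - NB)

/-- The independent sources of randomness in one channel use. -/
inductive Source (N : ℕ) : Type
  /-- the transmitted vector -/
  | message : Source N
  /-- the channel from Alice to Eve -/
  | aliceEve : Source N
  /-- the channel from all the jammers to Eve -/
  | jamEve : Source N
  /-- the channel from one jammer to Bob, with the null space basis that this jammer uses -/
  | jamBob : Fin N → Source N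
  /-- the one-time pad -/
  | pad : Source N

/-- `K` channel uses of the cooperative jamming wiretap system with a noiseless eavesdropper.
Alice, Bob and Eve have `NA`, `NB`, `NE` antennas, jammer `j` has `NJ j` antennas, `M` is the
constellation size and `P` is the peak jamming power. Except for its support, nothing is
assumed about the law of the one-time pad. -/
structure Wiretap (NA NB NE : ℕ) {N : ℕ} (NJ : Fin N → ℕ) (K M : ℕ) (P : ℝ)
    {Ω : Type*} [MeasurableSpace Ω] (μ : Measure Ω) where
  /-- transmitted vectors -/
  u : Fin K → Ω → Fin NA → ℂ
  /-- channels from Alice to Eve -/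
  G : Fin K → Ω → Fin NE → Fin NA → ℂ
  /-- channels from all the jammers to Eve -/
  HJE : Fin K → Ω → Fin NE → JamAntenna NJ → ℂ
  /-- channels from each jammer to Bob -/
  HJB : Fin K → (j : Fin N) → Ω → Fin NB → Fin (NJ j) → ℂ
  /-- precoding matrix of each jammer -/
  Z : Fin K → (j : Fin N) → Ω → Fin (NJ j) → Fin (NJ j - NB) → ℂ
  /-- one-time pads -/
  v : Fin K → Ω → EuclideanSpace ℂ (PadIndex NB NJ)
  measurable_u : ∀ i, Measurable (u i)
  measurable_G : ∀ i, Measurable (G i)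
  measurable_HJE : ∀ i, Measurable (HJE i)
  measurable_HJB : ∀ i j, Measurable (HJB i j)
  measurable_Z : ∀ i j, Measurable (Z i j)
  measurable_v : ∀ i, Measurable (v i)
  law_u : ∀ i, μ.map (u i) = uniformOn (constellation NA M)
  law_G : ∀ i, μ.map (G i) = gaussianMatrix (Fin NE) (Fin NA)
  law_HJE : ∀ i, μ.map (HJE i) = gaussianMatrix (Fin NE) (JamAntenna NJ)
  law_HJB : ∀ i j, μ.map (HJB i j) = gaussianMatrix (Fin NB) (Fin (NJ j))
  /-- the columns of the precoding matrix lie in the null space of the channel to Bob -/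
  null_Z : ∀ i j, ∀ᵐ ω ∂μ, Matrix.of (HJB i j ω) * Matrix.of (Z i j ω) = 0
  /-- the columns of the precoding matrix are orthonormal -/
  orthonormal_Z : ∀ i j, ∀ᵐ ω ∂μ,
    (Matrix.of (Z i j ω)).conjTranspose * Matrix.of (Z i j ω) = 1
  /-- the pad lies in the ball allowed by the peak power -/
  power_v : ∀ i, ∀ᵐ ω ∂μ, ‖v i ω‖ ^ 2 ≤ P
  /-- all the sources, over all the channel uses, are mutually independent -/
  indep : iIndep (fun s : Fin K × Source N =>
    match s with
    | (i, .message) => MeasurableSpace.comap (u i) inferInstance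
    | (i, .aliceEve) => MeasurableSpace.comap (G i) inferInstance
    | (i, .jamEve) => MeasurableSpace.comap (HJE i) inferInstance
    | (i, .jamBob j) => MeasurableSpace.comap (fun ω => (HJB i j ω, Z i j ω)) inferInstance
    | (i, .pad) => MeasurableSpace.comap (v i) inferInstance) μ

namespace Wiretap

variable {NA NB NE N : ℕ} {NJ : Fin N → ℕ} {K M : ℕ} {P : ℝ}
  {Ω : Type*} [MeasurableSpace Ω] {μ : Measure Ω}

/-- The effective channel from the one-time pad to Eve: the product of the horizontally stacked
jammer-to-Eve channels and the block diagonal matrix of the precoders. -/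
def padChannel (W : Wiretap NA NB NE NJ K M P μ) (i : Fin K) (ω : Ω) :
    Matrix (Fin NE) (PadIndex NB NJ) ℂ :=
  Matrix.of (W.HJE i ω) * Matrix.blockDiagonal' fun j => Matrix.of (W.Z i j ω)

/-- The point of Eve's receive space that belongs to the input vector `q`. -/
def point (W : Wiretap NA NB NE NJ K M P μ) (i : Fin K) (ω : Ω) (q : Fin NA → ℂ) :
    EuclideanSpace ℂ (Fin NE) :=
  WithLp.toLp 2 ((Matrix.of (W.G i ω)).mulVec q)

/-- The jamming signal at Eve caused by the pad `x`. -/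
def jam (W : Wiretap NA NB NE NJ K M P μ) (i : Fin K) (ω : Ω)
    (x : EuclideanSpace ℂ (PadIndex NB NJ)) : EuclideanSpace ℂ (Fin NE) :=
  WithLp.toLp 2 ((W.padChannel i ω).mulVec x.ofLp)

/-- Eve's (noiseless) observation. -/
def y (W : Wiretap NA NB NE NJ K M P μ) (i : Fin K) (ω : Ω) : EuclideanSpace ℂ (Fin NE) :=
  W.point i ω (W.u i ω) + W.jam i ω (W.v i ω)

/-- The largest norm of a jamming signal under the peak power constraint. -/
def Rmax (W : Wiretap NA NB NE NJ K M P μ) (i : Fin K) (ω : Ω) : ℝ :=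
  sSup ((fun x => ‖W.jam i ω x‖) '' {x | ‖x‖ ^ 2 ≤ P})

/-- The finite lattice seen by Eve. -/
def finiteLattice (W : Wiretap NA NB NE NJ K M P μ) (i : Fin K) (ω : Ω) :
    Set (EuclideanSpace ℂ (Fin NE)) :=
  W.point i ω '' constellation NA M

/-- The effective key space size: the number of points of the finite lattice in the ball of
radius `Rmax` around Eve's observation. -/
def L (W : Wiretap NA NB NE NJ K M P μ) (i : Fin K) (ω : Ω) : ℕ :=
  (Metric.closedBall (W.y i ω) (W.Rmax i ω) ∩ W.finiteLattice i ω).ncard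

/-- The secrecy outage probability. -/
def Pout (W : Wiretap NA NB NE NJ K M P μ) (d : ℕ) : ℝ :=
  1 - μ.real {ω | ∀ i, d ≤ W.L i ω}

/-- The input vectors that are compatible with Eve's observation in channel use `i`. -/
def candidates (W : Wiretap NA NB NE NJ K M P μ) (i : Fin K) (ω : Ω) : Set (Fin NA → ℂ) :=
  {q ∈ constellation NA M |
    W.point i ω q ∈ Metric.closedBall (W.y i ω) (W.Rmax i ω) ∩ W.finiteLattice i ω}

/-- Eve's posterior probability of the input `q` in channel use `i`, given her observation of
this channel use: the uniform prior, conditioned on the candidates. -/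
def posterior (W : Wiretap NA NB NE NJ K M P μ) (i : Fin K) (ω : Ω) (q : Fin NA → ℂ) : ENNReal :=
  cond (uniformOn (constellation NA M)) (W.candidates i ω) {q}

/-- Eve's posterior probability of the input `q` in channel use `i`, given her observations of
all the `K` channel uses: the uniform prior on sequences, conditioned on the candidates. -/
def jointPosterior (W : Wiretap NA NB NE NJ K M P μ) (i : Fin K) (ω : Ω) (q : Fin NA → ℂ) :
    ENNReal :=
  cond (uniformOn {s : Fin K → Fin NA → ℂ | ∀ k, s k ∈ constellation NA M})
    {s | ∀ k, s k ∈ W.candidates k ω} {s | s i = q}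

/-- Ideal secrecy: in every channel use there are at least two candidates, they are equally
likely for Eve, and her observations of the other channel uses do not help her. -/
def IdealSecrecy (W : Wiretap NA NB NE NJ K M P μ) (ω : Ω) : Prop :=
  ∀ i, 2 ≤ W.L i ω ∧ ∀ q ∈ W.candidates i ω,
    W.jointPosterior i ω q = W.posterior i ω q ∧ W.posterior i ω q = (W.L i ω : ENNReal)⁻¹

end Wiretap

/-- `N_min = min {NE - NA + 1, NA}`, used only for `NA ≤ NE`. -/
def Nmin (NA NE : ℕ) : ℕ :=
  min (NE - NA + 1) NA

/-- `κ(d) = d ^ (1 / (2 NE)) / √π`. -/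
def kappa (NE d : ℕ) : ℝ :=
  (d : ℝ) ^ (1 / (2 * (NE : ℝ))) / Real.sqrt Real.pi

/-- `Φ = ((NE - NA)! / NE!) ^ (1 / (2 NA))`, used only for `NA ≤ NE`. -/
def Phi (NA NE : ℕ) : ℝ :=
  ((Nat.factorial (NE - NA) : ℝ) / (Nat.factorial NE : ℝ)) ^ (1 / (2 * (NA : ℝ)))

/-- The jamming power `ε ^ (-2 / N_min) κ(d)² / Φ ^ (2 NA / NE)`. -/
def jamPower (NA NE d : ℕ) (ε : ℝ) : ℝ :=
  ε ^ (-2 / (Nmin NA NE : ℝ)) * kappa NE d ^ 2 / Phi NA NE ^ (2 * (NA : ℝ) / (NE : ℝ))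

end

end USK

/-!
Fix a channel use, and write `g a` for the columns of Eve's channel `G`, and `w` for the jamming
signal of the pad scaled up to the maximal norm `√P`. The actual jamming signal is `t • w` with
`0 ≤ t ≤ 1`, and `‖w‖ ≤ Rmax`.

*Many candidates from one column.* If `d * ‖g a‖ ^ 2 < |⟪w, g a⟫|` for some `a`, then one of the
four Gaussian units `σ` turns `g a` so much towards `w` that all the points
`G (u + k • σ • e a)`, `k < d`, lie in Eve's ball (`exists_unit_norm_smul_sub_le`,
`Wiretap.le_L`). These are inputs from the constellation unless `u` is within `d` of its boundary,
which has probability `O(1 / √M) = O(ε)` (`uniformOn_compl_innerConstellation_le`). So no lattice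
reduction and no singular values enter: one coordinate of the input suffices.

*The bad event.* It remains to bound the probability that every column is nearly orthogonal to
`w`, that is `|⟪w, g a⟫| ≤ d * ‖g a‖ ^ 2` for all `a`. For fixed `w` this has probability
`O(1 / ‖w‖)` for one column (`exists_nearlyOrthogonal_le`), by the bounded density of the Gaussian
and its fourth moment; the columns are independent, so `Nmin ≤ NA` of them give
`O(‖w‖ ^ (-Nmin))`. Now `w = H x`, where `H` is the Gaussian channel of the jammers and `x`, the
precoded pad, has norm `√P` because the precoders are isometries, and is independent of `G` and
`H`. Bounding `‖w‖` from below by `Nmin ≤ NE` different entries of `H x`, which are independent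
with `E (1 / |(H x) e|) = O(1 / √P)`, gives `O(P ^ (-Nmin / 2)) = O(ε)`
(`exists_forall_nearlyOrthogonal_le`, `sqrt_div_jamPower_pow`). The law of the pad plays no role.

*Ideal secrecy.* Almost surely `G` is injective on the finite constellation, so the number of
candidates is `L`; the posteriors are uniform laws on the candidates and on products of
them, and ideal secrecy follows from `2 ≤ d ≤ L` (`Wiretap.idealSecrecy_of_injOn`).
-/

namespace USK

/-! ### Small balls and tails of complex Gaussians -/

open scoped ENNReal

lemma gaussianReal_closedBall_le (b r : ℝ) :
    gaussianReal 0 (1 / 2) (Metric.closedBall b r) ≤ ENNReal.ofReal (2 * r) := by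
  have hv : (1 / 2 : NNReal) ≠ 0 := by norm_num
  rw [gaussianReal_apply _ hv]
  calc ∫⁻ x in Metric.closedBall b r, gaussianPDF 0 (1 / 2) x
      ≤ ∫⁻ _ in Metric.closedBall b r, 1 := by
        refine lintegral_mono fun x => ?_
        rw [gaussianPDF, ← ENNReal.ofReal_one]
        refine ENNReal.ofReal_le_ofReal ?_
        rw [gaussianPDFReal]
        have h1 : (√(2 * Real.pi * ((1 / 2 : NNReal) : ℝ)))⁻¹ ≤ 1 := by
          apply inv_le_one_of_one_le₀
          rw [Real.one_le_sqrt]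
          have := Real.pi_gt_three
          push_cast
          linarith
        have h2 : Real.exp (-(x - 0) ^ 2 / (2 * ((1 / 2 : NNReal) : ℝ))) ≤ 1 := by
          rw [Real.exp_le_one_iff]
          push_cast
          nlinarith [sq_nonneg (x - 0)]
        exact mul_le_one₀ h1 (Real.exp_pos _).le h2
    _ = ENNReal.ofReal (2 * r) := by simp [Real.volume_closedBall]

instance : IsProbabilityMeasure complexGaussian := by
  unfold complexGaussian
  exact Measure.isProbabilityMeasure_map
    Complex.measurableEquivRealProd.symm.measurable.aemeasurable

instance (m n : Type*) [Fintype m] [Fintype n] : IsProbabilityMeasure (gaussianMatrix m n) := by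
  unfold gaussianMatrix
  infer_instance

/-- The density of `complexGaussian` is bounded, so a disc of radius `r` has mass `O(r ^ 2)`,
uniformly in its centre. -/
lemma complexGaussian_closedBall_le (b : ℂ) (r : ℝ) :
    complexGaussian (Metric.closedBall b r) ≤ ENNReal.ofReal (4 * r ^ 2) := by
  rcases lt_or_ge r 0 with hr | hr
  · simp [Metric.closedBall_eq_empty.2 hr]
  have hm : Measurable (Complex.equivRealProd.symm : ℝ × ℝ → ℂ) :=
    Complex.measurableEquivRealProd.symm.measurable
  rw [complexGaussian, Measure.map_apply hm Metric.isClosed_closedBall.measurableSet]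
  calc _ ≤ ((gaussianReal 0 (1 / 2)).prod (gaussianReal 0 (1 / 2)))
        (Metric.closedBall b.re r ×ˢ Metric.closedBall b.im r) := by
        refine measure_mono fun p hp => ?_
        simp only [Set.mem_preimage, Metric.mem_closedBall, Complex.dist_eq] at hp
        simp only [Set.mem_prod, Metric.mem_closedBall, Real.dist_eq]
        have h1 := (Complex.abs_re_le_norm _).trans hp
        have h2 := (Complex.abs_im_le_norm _).trans hp
        simp only [Complex.sub_re, Complex.sub_im, Complex.equivRealProd_symm_apply, Complex.add_re,
          Complex.add_im, Complex.ofReal_re, Complex.ofReal_im, Complex.re_ofReal_mul,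
          Complex.im_ofReal_mul, Complex.I_re, Complex.I_im, mul_zero, mul_one, add_zero,
          zero_add] at h1 h2
        exact ⟨h1, h2⟩
    _ ≤ ENNReal.ofReal (2 * r) * ENNReal.ofReal (2 * r) := by
        rw [Measure.prod_prod]
        gcongr <;> exact gaussianReal_closedBall_le _ _
    _ = ENNReal.ofReal (4 * r ^ 2) := by
        rw [← ENNReal.ofReal_mul (by positivity)]
        ring_nf

lemma complexGaussian_fourth_moment_lt_top : eLpNorm id 4 complexGaussian < ∞ := by
  have hm : Measurable (Complex.equivRealProd.symm : ℝ × ℝ → ℂ) :=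
    Complex.measurableEquivRealProd.symm.measurable
  have h4 : MemLp id 4 (gaussianReal 0 (1 / 2)) := memLp_id_gaussianReal' 4 (by norm_num)
  have h1 : MemLp (fun p : ℝ × ℝ => (p.1 : ℂ)) 4
      ((gaussianReal 0 (1 / 2)).prod (gaussianReal 0 (1 / 2))) :=
    (h4.comp_fst _).ofReal
  have h2 : MemLp (fun p : ℝ × ℝ => (p.2 : ℂ)) 4
      ((gaussianReal 0 (1 / 2)).prod (gaussianReal 0 (1 / 2))) :=
    (h4.comp_snd _).ofReal
  rw [complexGaussian, eLpNorm_map_measure aestronglyMeasurable_id hm.aemeasurable]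
  refine (MemLp.eLpNorm_lt_top (f := fun p : ℝ × ℝ => (p.1 : ℂ) + Complex.I * p.2)
    (h1.add (h2.const_mul Complex.I))).trans_eq' ?_
  congr 1
  ext p
  simp [Complex.equivRealProd_symm_apply, mul_comm]

/-- Markov's inequality for the fourth moment. -/
lemma exists_complexGaussian_tail_le : ∃ m : ℝ, 0 ≤ m ∧ ∀ t : ℝ, 0 < t →
    complexGaussian {z | t ≤ ‖z‖ ^ 4} ≤ ENNReal.ofReal (m / t) := by
  have hfin : eLpNorm id 4 complexGaussian ^ (4 : ℝ≥0∞).toReal ≠ ∞ :=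
    ENNReal.rpow_ne_top_of_nonneg (by positivity) complexGaussian_fourth_moment_lt_top.ne
  refine ⟨(eLpNorm id 4 complexGaussian ^ (4 : ℝ≥0∞).toReal).toReal, by positivity, fun t ht => ?_⟩
  have h := mul_meas_ge_le_pow_eLpNorm complexGaussian (p := 4) (by norm_num) (by norm_num)
    (f := (id : ℂ → ℂ)) aestronglyMeasurable_id (ENNReal.ofReal t)
  have hset : {z : ℂ | ENNReal.ofReal t ≤ ‖id z‖ₑ ^ (4 : ℝ≥0∞).toReal} = {z | t ≤ ‖z‖ ^ 4} := by
    ext z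
    simp only [Set.mem_ofPred_eq, id, ENNReal.toReal_ofNat]
    rw [← ofReal_norm, ENNReal.ofReal_rpow_of_nonneg (norm_nonneg _) (by norm_num),
      ENNReal.ofReal_le_ofReal_iff (by positivity)]
    norm_cast
  rw [hset] at h
  rw [ENNReal.ofReal_div_of_pos ht, ENNReal.ofReal_toReal hfin]
  rw [ENNReal.le_div_iff_mul_le (by simp [ht]) (by simp), mul_comm]
  exact h

/-- Adding an independent summand does not increase the concentration of a random variable. -/
lemma IndepFun.measure_norm_add_le {Ω : Type*} [MeasurableSpace Ω] {μ : Measure Ω}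
    [IsProbabilityMeasure μ] {X Y : Ω → ℂ} (hX : Measurable X) (hY : Measurable Y)
    (h : IndepFun X Y μ) {r : ℝ} {q : ℝ≥0∞} (hq : ∀ b, μ (X ⁻¹' Metric.closedBall b r) ≤ q) :
    μ {ω | ‖X ω + Y ω‖ ≤ r} ≤ q := by
  have : IsProbabilityMeasure (μ.map X) := Measure.isProbabilityMeasure_map hX.aemeasurable
  have : IsProbabilityMeasure (μ.map Y) := Measure.isProbabilityMeasure_map hY.aemeasurable
  have hs : MeasurableSet {p : ℂ × ℂ | ‖p.1 + p.2‖ ≤ r} :=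
    measurableSet_le (by fun_prop) (by fun_prop)
  have e : {ω | ‖X ω + Y ω‖ ≤ r} = (fun ω => (X ω, Y ω)) ⁻¹' {p : ℂ × ℂ | ‖p.1 + p.2‖ ≤ r} := rfl
  rw [e, ← Measure.map_apply (hX.prodMk hY) hs,
    (indepFun_iff_map_prod_eq_prod_map_map hX.aemeasurable hY.aemeasurable).1 h,
    Measure.prod_apply_symm hs]
  calc _ ≤ ∫⁻ _, q ∂(μ.map Y) := by
        refine lintegral_mono fun y => ?_
        have : (fun x => (x, y)) ⁻¹' {p : ℂ × ℂ | ‖p.1 + p.2‖ ≤ r} = Metric.closedBall (-y) r := by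
          ext x
          simp [dist_eq_norm]
        rw [this, Measure.map_apply hX Metric.isClosed_closedBall.measurableSet]
        exact hq _
    _ = q := by simp

variable {ι : Type*} [Fintype ι]

/-- A linear form in i.i.d. complex Gaussians is as spread out as any one of its terms. -/
lemma pi_complexGaussian_norm_sum_le (x : ι → ℂ) (j : ι) (hx : x j ≠ 0) (r : ℝ) :
    Measure.pi (fun _ : ι => complexGaussian) {g | ‖∑ i, g i * x i‖ ≤ r} ≤
      ENNReal.ofReal (4 * (r / ‖x j‖) ^ 2) := by
  classical
  have hI : iIndepFun (fun i (g : ι → ℂ) => g i * x i) (Measure.pi fun _ : ι => complexGaussian) :=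
    iIndepFun_pi (X := fun i z => z * x i) fun i => (by fun_prop)
  have h2 := (hI.indepFun_finsetSum_of_notMem (fun i => by fun_prop)
    (Finset.notMem_erase j Finset.univ)).symm
  have h3 := IndepFun.measure_norm_add_le (r := r) (q := ENNReal.ofReal (4 * (r / ‖x j‖) ^ 2))
    (X := fun g : ι → ℂ => g j * x j) (Y := ∑ i ∈ Finset.univ.erase j, fun g : ι → ℂ => g i * x i)
    (by fun_prop) (by fun_prop) h2 ?_
  · convert h3 using 5 with g
    rw [Finset.sum_apply, Finset.add_sum_erase Finset.univ (fun i => g i * x i) (Finset.mem_univ j)]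
  · intro b
    have e : (fun g : ι → ℂ => g j * x j) ⁻¹' Metric.closedBall b r =
        Function.eval j ⁻¹' Metric.closedBall (b / x j) (r / ‖x j‖) := by
      ext g
      simp only [Set.mem_preimage, Metric.mem_closedBall, dist_eq_norm, Function.eval]
      rw [le_div_iff₀ (norm_pos_iff.2 hx), ← norm_mul, sub_mul, div_mul_cancel₀ _ hx]
    rw [e, (measurePreserving_eval (fun _ : ι => complexGaussian) j).measure_preimage
      Metric.isClosed_closedBall.measurableSet.nullMeasurableSet]
    exact complexGaussian_closedBall_le _ _

/-- A quadratic small ball estimate makes the first inverse moment finite: compare `1 / ‖ξ‖`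
with a sum over the dyadic scales `‖ξ‖ ≤ 2 ^ (-n)`. -/
lemma lintegral_inv_enorm_le {Ω : Type*} [MeasurableSpace Ω] {μ : Measure Ω}
    [IsProbabilityMeasure μ] {ξ : Ω → ℂ} (hξ : Measurable ξ)
    (h : ∀ r : ℝ, μ {ω | ‖ξ ω‖ ≤ r} ≤ ENNReal.ofReal (4 * r ^ 2)) :
    ∫⁻ ω, ‖ξ ω‖ₑ⁻¹ ∂μ ≤ 17 := by
  set A : ℕ → Set Ω := fun n => {ω | ‖ξ ω‖ ≤ (1 / 2) ^ n} with hA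
  have hAm : ∀ n, MeasurableSet (A n) := fun n => measurableSet_le (by fun_prop) (by fun_prop)
  have key : ∀ ω, ‖ξ ω‖ₑ⁻¹ ≤ 1 + ∑' n, (A n).indicator (fun _ => (2 : ℝ≥0∞) ^ (n + 1)) ω := by
    intro ω
    rcases lt_or_ge 1 ‖ξ ω‖ with h1 | h1
    · refine le_add_right ?_
      rw [ENNReal.inv_le_one, ← ofReal_norm, ENNReal.one_le_ofReal]
      exact h1.le
    · refine le_add_left ?_
      rcases (norm_nonneg (ξ ω)).eq_or_lt with h0 | h0
      · have : ∀ n, (2 : ℝ≥0∞) ^ (n + 1) ≤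
            ∑' n, (A n).indicator (fun _ => (2 : ℝ≥0∞) ^ (n + 1)) ω := fun n => by
          refine le_trans ?_ (ENNReal.le_tsum n)
          rw [Set.indicator_of_mem]
          simp [hA, ← h0]
        have h3 : ∑' n, (A n).indicator (fun _ => (2 : ℝ≥0∞) ^ (n + 1)) ω = ∞ := by
          by_contra hne
          obtain ⟨n, hn⟩ := ENNReal.exists_nat_gt hne
          have h5 : (n : ℝ≥0∞) ≤ 2 ^ (n + 1) := by
            exact_mod_cast (Nat.lt_two_pow_self.le.trans (Nat.pow_le_pow_right two_pos n.le_succ))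
          exact absurd (hn.trans_le (h5.trans (this n))) (lt_irrefl _)
        rw [h3]
        exact le_top
      · obtain ⟨n, hn1, hn2⟩ := exists_nat_pow_near_of_lt_one h0 h1
          (by norm_num : (0 : ℝ) < 1 / 2) (by norm_num)
        refine le_trans ?_ (ENNReal.le_tsum n)
        rw [Set.indicator_of_mem (by simpa [hA] using hn2)]
        rw [← ofReal_norm, ← ENNReal.ofReal_inv_of_pos h0]
        have : (2 : ℝ≥0∞) ^ (n + 1) = ENNReal.ofReal (2 ^ (n + 1)) := by
          rw [ENNReal.ofReal_pow (by norm_num)]; simp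
        rw [this]
        refine ENNReal.ofReal_le_ofReal ?_
        rw [inv_le_comm₀ h0 (by positivity)]
        refine hn1.le.trans' ?_
        rw [one_div, inv_pow]
  calc ∫⁻ ω, ‖ξ ω‖ₑ⁻¹ ∂μ
      ≤ ∫⁻ ω, 1 + ∑' n, (A n).indicator (fun _ => (2 : ℝ≥0∞) ^ (n + 1)) ω ∂μ := lintegral_mono key
    _ = 1 + ∑' n, 2 ^ (n + 1) * μ (A n) := by
        rw [lintegral_add_left measurable_const, lintegral_tsum fun n =>
          (measurable_const.indicator (hAm n)).aemeasurable]
        simp [lintegral_indicator_const (hAm _)]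
    _ ≤ 1 + ∑' n, 8 * (2⁻¹) ^ n := by
        refine add_le_add_right (ENNReal.tsum_le_tsum fun n => ?_) _
        refine (mul_le_mul_right (h _) _).trans_eq ?_
        have : (2 : ℝ≥0∞) ^ (n + 1) = ENNReal.ofReal (2 ^ (n + 1)) := by
          rw [ENNReal.ofReal_pow (by norm_num)]; simp
        have h2 : (8 : ℝ≥0∞) * 2⁻¹ ^ n = ENNReal.ofReal (8 * (1 / 2) ^ n) := by
          rw [ENNReal.ofReal_mul (by norm_num), ENNReal.ofReal_pow (by norm_num), one_div,
            ENNReal.ofReal_inv_of_pos (by norm_num)]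
          simp
        rw [this, h2, ← ENNReal.ofReal_mul (by positivity)]
        congr 1
        rw [pow_succ, ← pow_mul, mul_comm n 2, pow_mul]
        have : (2 : ℝ) ^ n * ((1 / 2) ^ n) = 1 := by rw [← mul_pow]; norm_num
        rw [pow_two, mul_pow]
        linear_combination 8 * (1 / 2) ^ n * this
    _ = 17 := by
        rw [ENNReal.tsum_mul_left, ENNReal.tsum_geometric, ENNReal.one_sub_inv_two, inv_inv]
        norm_num

lemma lintegral_inv_enorm_sum_le (x : ι → ℂ) (j : ι) (hx : x j ≠ 0) :
    ∫⁻ g, ‖∑ i, g i * x i‖ₑ⁻¹ ∂(Measure.pi fun _ : ι => complexGaussian) ≤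
      17 * ‖x j‖ₑ⁻¹ := by
  have h := lintegral_inv_enorm_le (μ := Measure.pi fun _ : ι => complexGaussian)
    (ξ := fun g => (∑ i, g i * x i) / x j) (by fun_prop) fun r => by
      have := pi_complexGaussian_norm_sum_le x j hx (r * ‖x j‖)
      rw [mul_div_cancel_right₀ _ (norm_ne_zero_iff.2 hx)] at this
      convert this using 4
      rw [norm_div, div_le_iff₀ (norm_pos_iff.2 hx)]
  have h0 : ‖x j‖ₑ ≠ 0 := enorm_ne_zero.2 hx
  calc _ = ∫⁻ g, ‖(∑ i, g i * x i) / x j‖ₑ⁻¹ * ‖x j‖ₑ⁻¹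
        ∂(Measure.pi fun _ : ι => complexGaussian) := by
        refine lintegral_congr fun g => ?_
        rw [← ENNReal.mul_inv (Or.inr enorm_ne_top) (Or.inr h0), ← enorm_mul,
          div_mul_cancel₀ _ hx]
    _ = (∫⁻ g, ‖(∑ i, g i * x i) / x j‖ₑ⁻¹
        ∂(Measure.pi fun _ : ι => complexGaussian)) * ‖x j‖ₑ⁻¹ :=
        lintegral_mul_const _ (by fun_prop)
    _ ≤ _ := by gcongr

end USK

namespace USK

/-! ### Gaussian channels nearly orthogonal to the jamming signal -/

open scoped ENNReal NNReal ComplexConjugate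

/-- The channel vectors `g` that are nearly orthogonal to `w`, on the scale `‖g‖ ^ 2`. -/
def nearlyOrthogonal {ι : Type*} [Fintype ι] (d : ℕ) (w : ι → ℂ) : Set (ι → ℂ) :=
  {g | ‖∑ e, g e * conj (w e)‖ ≤ d * ∑ e, ‖g e‖ ^ 2}

section

variable {ι : Type*} [Fintype ι]

lemma measurableSet_nearlyOrthogonal (d : ℕ) (w : ι → ℂ) :
    MeasurableSet (nearlyOrthogonal d w) :=
  measurableSet_le (by fun_prop) (by fun_prop)

/-- A Gaussian vector is nearly orthogonal to `w` with probability `O(1 / ‖w‖)`. -/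
lemma exists_nearlyOrthogonal_le (ι : Type*) [Fintype ι] (d : ℕ) :
    ∃ C : ℝ≥0, C ≠ 0 ∧ ∀ (w : ι → ℂ) (e : ι),
      Measure.pi (fun _ : ι => complexGaussian) (nearlyOrthogonal d w) ≤ C * ‖w e‖ₑ⁻¹ := by
  obtain ⟨m, hm0, hm⟩ := exists_complexGaussian_tail_le
  set n : ℝ := (Fintype.card ι : ℝ) with hn
  have hn0 : 0 ≤ n := Nat.cast_nonneg _
  have hC0 : 0 < 4 * (d * n) ^ 2 + n * m + 1 := by positivity
  have hC1 : Real.toNNReal (4 * (d * n) ^ 2 + n * m + 1) ≠ 0 := (Real.toNNReal_pos.2 hC0).ne'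
  refine ⟨Real.toNNReal (4 * (d * n) ^ 2 + n * m + 1), hC1, fun w e => ?_⟩
  have : Nonempty ι := ⟨e⟩
  rcases eq_or_ne w 0 with rfl | hw
  · rw [Pi.zero_apply, enorm_zero, ENNReal.inv_zero, ENNReal.mul_top (by exact_mod_cast hC1)]
    exact le_top
  have hw0 : 0 < ‖w‖ := norm_pos_iff.2 hw
  obtain ⟨j, hjmax⟩ := Finite.exists_max fun e => ‖w e‖
  have hj : ‖w j‖ = ‖w‖ :=
    le_antisymm (norm_le_pi_norm w j) ((pi_norm_le_iff_of_nonneg (norm_nonneg _)).2 hjmax)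
  -- Either some entry of `g` exceeds `‖w‖ ^ (1 / 4)`, or the scalar product is
  -- `O(‖w‖ ^ (1 / 2))`.
  have hsub : nearlyOrthogonal d w ⊆
      {g | ‖∑ e, g e * conj (w e)‖ ≤ d * (n * √‖w‖)} ∪
        ⋃ e, Function.eval e ⁻¹' {z : ℂ | ‖w‖ ≤ ‖z‖ ^ 4} := by
    intro g hg
    by_cases h : ∃ e, ‖w‖ ≤ ‖g e‖ ^ 4
    · exact Or.inr (Set.mem_iUnion.2 h)
    · push Not at h
      rw [nearlyOrthogonal, Set.mem_ofPred_eq] at hg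
      refine Or.inl (Set.mem_ofPred_eq ▸ hg.trans ?_)
      gcongr
      calc ∑ e, ‖g e‖ ^ 2 ≤ ∑ e : ι, √‖w‖ := by
            refine Finset.sum_le_sum fun e _ => Real.le_sqrt_of_sq_le ?_
            rw [← pow_mul]
            exact (h e).le
        _ = n * √‖w‖ := by simp [hn]
  have hmeas : MeasurableSet {z : ℂ | ‖w‖ ≤ ‖z‖ ^ 4} := measurableSet_le (by fun_prop) (by fun_prop)
  have h1 := pi_complexGaussian_norm_sum_le (fun e => conj (w e)) j
    (by simpa [← norm_pos_iff, hj] using hw0) (d * (n * √‖w‖))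
  have hcalc : 4 * (d * (n * √‖w‖) / ‖w‖) ^ 2 = 4 * (d * n) ^ 2 / ‖w‖ := by
    rw [div_pow, ← mul_assoc, mul_pow, Real.sq_sqrt hw0.le]
    field_simp
  calc Measure.pi (fun _ : ι => complexGaussian) (nearlyOrthogonal d w)
      ≤ Measure.pi (fun _ : ι => complexGaussian) {g | ‖∑ e, g e * conj (w e)‖ ≤ d * (n * √‖w‖)}
        + ∑ e : ι, Measure.pi (fun _ : ι => complexGaussian)
          (Function.eval e ⁻¹' {z : ℂ | ‖w‖ ≤ ‖z‖ ^ 4}) := by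
        refine (measure_mono hsub).trans ((measure_union_le _ _).trans ?_)
        gcongr
        exact measure_iUnion_fintype_le _ _
    _ ≤ ENNReal.ofReal (4 * (d * n) ^ 2 / ‖w‖) + ∑ e : ι, ENNReal.ofReal (m / ‖w‖) := by
        gcongr with e
        · rw [RCLike.norm_conj, hj, hcalc] at h1
          exact h1
        · rw [(measurePreserving_eval (fun _ : ι => complexGaussian) e).measure_preimage
            hmeas.nullMeasurableSet]
          exact hm _ hw0
    _ = ENNReal.ofReal ((4 * (d * n) ^ 2 + n * m) / ‖w‖) := by
        rw [← ENNReal.ofReal_sum_of_nonneg fun _ _ => by positivity,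
          ← ENNReal.ofReal_add (by positivity) (by positivity)]
        simp only [Finset.sum_const, Finset.card_univ, nsmul_eq_mul, ← hn]
        ring_nf
    _ ≤ ENNReal.ofReal ((4 * (d * n) ^ 2 + n * m + 1) / ‖w‖) := by
        exact ENNReal.ofReal_le_ofReal (div_le_div_of_nonneg_right (by linarith) hw0.le)
    _ = ENNReal.ofReal (4 * (d * n) ^ 2 + n * m + 1) * ‖w‖ₑ⁻¹ := by
        rw [ENNReal.ofReal_div_of_pos hw0, ofReal_norm, div_eq_mul_inv]
    _ ≤ _ := by
        rw [ENNReal.ofReal]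
        gcongr
        exact enorm_le_iff_norm_le.2 (norm_le_pi_norm w e)

/-- The transpose of a Gaussian matrix is a Gaussian matrix. -/
lemma measurePreserving_transpose_gaussianMatrix (m n : Type*) [Fintype m] [Fintype n] :
    MeasurePreserving (fun (G : m → n → ℂ) a e => G e a) (gaussianMatrix m n)
      (gaussianMatrix n m) := by
  refine ⟨by fun_prop, Eq.symm ?_⟩
  refine Measure.pi_eq_generateFrom (C := fun _ => Set.pi Set.univ '' Set.pi Set.univ
    fun _ => {s : Set ℂ | MeasurableSet s}) (fun _ => generateFrom_pi) (fun _ => isPiSystem_pi)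
    (fun _ => ?_) fun s hs => ?_
  · exact (Measure.FiniteSpanningSetsIn.pi fun _ => complexGaussian.toFiniteSpanningSetsIn)
  · choose t ht hts using hs
    simp only [Set.mem_pi, Set.mem_univ, forall_const, Set.mem_ofPred_eq] at ht
    rw [Measure.map_apply (by fun_prop) (MeasurableSet.univ_pi fun a => by
      rw [← hts]; exact MeasurableSet.univ_pi fun e => ht a e)]
    have e : (fun (G : m → n → ℂ) a e => G e a) ⁻¹' Set.pi Set.univ s =
        Set.pi Set.univ fun e => Set.pi Set.univ fun a => t a e := by
      ext G
      simp only [← hts, Set.mem_preimage, Set.mem_pi, Set.mem_univ, forall_const]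
      exact forall_comm
    rw [e]
    simp only [gaussianMatrix, Measure.pi_pi, ← hts]
    exact Finset.prod_comm

lemma gaussianMatrix_forall_col {m n : Type*} [Fintype m] [Fintype n] {B : Set (m → ℂ)}
    (hB : MeasurableSet B) :
    gaussianMatrix m n {G | ∀ a, (fun e => G e a) ∈ B} =
      Measure.pi (fun _ : m => complexGaussian) B ^ Fintype.card n := by
  have h := (measurePreserving_transpose_gaussianMatrix m n).measure_preimage
    (MeasurableSet.univ_pi fun _ : n => hB).nullMeasurableSet
  have h2 : gaussianMatrix n m (Set.pi Set.univ fun _ => B) =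
      Measure.pi (fun _ : m => complexGaussian) B ^ Fintype.card n := by
    rw [gaussianMatrix, Measure.pi_pi, Finset.prod_const, Finset.card_univ]
  rw [← h2, ← h]
  congr 1
  ext G
  simp

/-- The probability that all the columns of the channel `G` are nearly orthogonal to the jamming
signal `H x`. Given `H x`, each column contributes a factor `O(1 / ‖H x‖)`; of these, `k` are kept
and paired with `k` rows of `H`, which are independent and have `E (1 / |(H x) e|) = O(1 / |x j|)`.
-/
lemma exists_forall_nearlyOrthogonal_le (m n : Type*) [Fintype m] [Fintype n] (d k : ℕ)
    (hkm : k ≤ Fintype.card m) (hkn : k ≤ Fintype.card n) :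
    ∃ C : ℝ≥0, ∀ (J : Type*) [Fintype J] (x : J → ℂ) (j : J), x j ≠ 0 →
      ((gaussianMatrix m n).prod (gaussianMatrix m J))
        {p | ∀ a, (fun e => p.1 e a) ∈ nearlyOrthogonal d fun e => ∑ j, p.2 e j * x j} ≤
      (C * ‖x j‖ₑ⁻¹) ^ k := by
  obtain ⟨C, hC0, hC⟩ := exists_nearlyOrthogonal_le m d
  obtain ⟨S, -, hS⟩ := Finset.exists_subset_card_eq (s := (Finset.univ : Finset m)) hkm
  refine ⟨C * 17, fun J _ x j hx => ?_⟩
  have hmeas : MeasurableSet {p : (m → n → ℂ) × (m → J → ℂ) | ∀ a, (fun e => p.1 e a) ∈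
      nearlyOrthogonal d fun e => ∑ j, p.2 e j * x j} := by
    simp only [nearlyOrthogonal, Set.mem_ofPred_eq, Set.ofPred_forall]
    exact MeasurableSet.iInter fun a => measurableSet_le (by fun_prop) (by fun_prop)
  rw [Measure.prod_apply_symm hmeas]
  calc _ ≤ ∫⁻ H, ∏ e ∈ S, (C * ‖∑ j, H e j * x j‖ₑ⁻¹ : ℝ≥0∞) ∂gaussianMatrix m J := by
        refine lintegral_mono fun H => ?_
        refine (gaussianMatrix_forall_col (n := n) (measurableSet_nearlyOrthogonal d fun e =>
          ∑ j, H e j * x j)).trans_le ?_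
        refine (pow_le_pow_right_of_le_one' prob_le_one hkn).trans ?_
        rw [← hS, ← Finset.prod_const]
        exact Finset.prod_le_prod' fun e _ => hC _ e
    _ = ∏ e ∈ S, ∫⁻ H, (C * ‖∑ j, H e j * x j‖ₑ⁻¹ : ℝ≥0∞) ∂gaussianMatrix m J := by
        have hind : iIndepFun (fun (e : m) (H : m → J → ℂ) => (C * ‖∑ j, H e j * x j‖ₑ⁻¹ : ℝ≥0∞))
            (gaussianMatrix m J) :=
          iIndepFun_pi (μ := fun _ : m => Measure.pi fun _ : J => complexGaussian)
            (X := fun (_ : m) (h : J → ℂ) => (C * ‖∑ j, h j * x j‖ₑ⁻¹ : ℝ≥0∞))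
            fun e => (by fun_prop : Measurable _).aemeasurable
        exact lintegral_prod_eq_prod_lintegral_of_indepFun S _ hind fun e => by fun_prop
    _ ≤ ∏ e ∈ S, ((C * 17 : ℝ≥0) * ‖x j‖ₑ⁻¹ : ℝ≥0∞) := by
        refine Finset.prod_le_prod' fun e _ => ?_
        rw [lintegral_const_mul _ (by fun_prop)]
        push_cast
        rw [mul_assoc]
        gcongr
        refine le_trans (le_of_eq ?_) (lintegral_inv_enorm_sum_le x j hx)
        exact (measurePreserving_eval (fun _ : m => Measure.pi fun _ : J => complexGaussian)
          e).lintegral_comp (f := fun h => ‖∑ j, h j * x j‖ₑ⁻¹) (by fun_prop)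
    _ = _ := by rw [Finset.prod_const, hS]

/-- A Gaussian matrix almost surely kills no given nonzero vector. -/
lemma ae_gaussianMatrix_mulVec_ne_zero {m n : Type*} [Fintype m] [Fintype n] [Nonempty m]
    {x : n → ℂ} (hx : x ≠ 0) :
    ∀ᵐ G ∂gaussianMatrix m n, (Matrix.of G).mulVec x ≠ 0 := by
  obtain ⟨j, hj⟩ := Function.ne_iff.1 hx
  let e : m := Classical.arbitrary m
  have h : ∀ᵐ g ∂Measure.pi (fun _ : n => complexGaussian), ∑ i, g i * x i ≠ 0 := by
    rw [ae_iff]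
    refine le_antisymm ((measure_mono ?_).trans
      ((pi_complexGaussian_norm_sum_le x j hj 0).trans (by simp))) zero_le
    intro g hg
    simpa using hg
  have h2 := (measurePreserving_eval (fun _ : m => Measure.pi fun _ : n => complexGaussian)
    e).quasiMeasurePreserving.ae h
  filter_upwards [h2] with G hG h0
  exact hG (congrFun h0 e)

end

end USK

namespace USK

/-! ### Counting in the constellation -/

open scoped ENNReal NNReal ComplexConjugate

section Counting

/-- Under the uniform law on a product of finite sets, each coordinate is uniform. -/
lemma uniformOn_piFinset_eval {ι α : Type*} [Fintype ι] [DecidableEq ι] [MeasurableSpace α]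
    [MeasurableSingletonClass α] (S : ι → Finset α) (hS : ∀ i, (S i).Nonempty) (i : ι)
    (B : Finset α) (hB : B ⊆ S i) :
    uniformOn (↑(Fintype.piFinset S) : Set (ι → α)) {s | s i ∈ B} = B.card / (S i).card := by
  classical
  have e : (↑(Fintype.piFinset S) : Set (ι → α)) ∩ {s | s i ∈ B} =
      ↑(Fintype.piFinset (Function.update S i B)) := by
    ext s
    simp only [Set.mem_inter_iff, Finset.mem_coe, Fintype.mem_piFinset, Set.mem_ofPred_eq]
    constructor
    · rintro ⟨h1, h2⟩ j
      rcases eq_or_ne j i with rfl | hj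
      · simpa using h2
      · simpa [Function.update_of_ne hj] using h1 j
    · intro h
      have hi : s i ∈ B := by simpa using h i
      refine ⟨fun j => ?_, hi⟩
      rcases eq_or_ne j i with rfl | hj
      · exact hB hi
      · simpa [Function.update_of_ne hj] using h j
  have hsub : Fintype.piFinset (Function.update S i B) ⊆ Fintype.piFinset S := by
    rw [← Finset.coe_subset, ← e]
    exact Set.inter_subset_left
  rw [← uniformOn_inter_self (Finset.finite_toSet _), e, uniformOn_apply_finset,
    Finset.inter_eq_right.2 hsub, Fintype.card_piFinset, Fintype.card_piFinset]
  have h1 : ∏ j, (Function.update S i B j).card =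
      B.card * ∏ j ∈ Finset.univ.erase i, (S j).card := by
    rw [← Finset.mul_prod_erase _ _ (Finset.mem_univ i), Function.update_self]
    congr 1
    exact Finset.prod_congr rfl fun j hj => by
      rw [Function.update_of_ne (Finset.ne_of_mem_erase hj)]
  rw [h1, ← Finset.mul_prod_erase Finset.univ (fun j => (S j).card) (Finset.mem_univ i)]
  push_cast
  refine ENNReal.mul_div_mul_right _ _ ?_ ?_
  · exact Finset.prod_ne_zero_iff.2 fun j _ => by exact_mod_cast (hS j).card_ne_zero
  · exact ENNReal.prod_ne_top fun j _ => ENNReal.natCast_ne_top _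

/-- The Gaussian integer with the given natural coordinates. -/
noncomputable def gaussNat (p : ℕ × ℕ) : ℂ := (p.1 : ℂ) + (p.2 : ℂ) * Complex.I

lemma gaussNat_injective : Function.Injective gaussNat := by
  intro p q h
  have h1 := congrArg Complex.re h
  have h2 := congrArg Complex.im h
  simp only [gaussNat, Complex.add_re, Complex.add_im, Complex.natCast_re, Complex.natCast_im,
    Complex.mul_re, Complex.mul_im, Complex.I_re, Complex.I_im, mul_zero, mul_one, zero_add,
    sub_zero, add_zero, Nat.cast_inj] at h1 h2
  exact Prod.ext h1 h2

/-- The `M`-QAM alphabet as a finset. -/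
noncomputable def qamFinset (M : ℕ) : Finset ℂ :=
  ((Finset.range M.sqrt) ×ˢ (Finset.range M.sqrt)).map ⟨gaussNat, gaussNat_injective⟩

lemma coe_qamFinset (M : ℕ) : (qamFinset M : Set ℂ) = qam M := by
  ext z
  simp only [qamFinset, Finset.coe_map, Function.Embedding.coeFn_mk, Set.mem_image, Finset.mem_coe,
    Finset.mem_product, Finset.mem_range, qam, Set.mem_ofPred_eq, Prod.exists, gaussNat]
  constructor
  · rintro ⟨a, b, ⟨h1, h2⟩, h⟩
    exact ⟨a, b, h1, h2, h.symm⟩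
  · rintro ⟨a, b, h1, h2, h⟩
    exact ⟨a, b, ⟨h1, h2⟩, h.symm⟩

lemma coe_piFinset_qamFinset (NA M : ℕ) :
    (↑(Fintype.piFinset fun _ : Fin NA => qamFinset M) : Set (Fin NA → ℂ)) =
      constellation NA M := by
  ext q
  simp only [Finset.mem_coe, Fintype.mem_piFinset, constellation, Set.mem_ofPred_eq,
    ← coe_qamFinset]

lemma finite_constellation (NA M : ℕ) : (constellation NA M).Finite := by
  rw [← coe_piFinset_qamFinset]
  exact Finset.finite_toSet _

/-- The coordinates in `{0, ..., m - 1}` that stay there when they are moved by less than `d`. -/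
def InnerCoord (d m α : ℕ) : Prop := d ≤ α ∧ α + d ≤ m

instance (d m : ℕ) : DecidablePred (InnerCoord d m) := fun _ => inferInstanceAs (Decidable (_ ∧ _))

/-- The vectors of the constellation at distance at least `d` from its boundary. -/
def innerConstellation (NA M d : ℕ) : Set (Fin NA → ℂ) :=
  {q | ∀ a, ∃ p : ℕ × ℕ, InnerCoord d M.sqrt p.1 ∧ InnerCoord d M.sqrt p.2 ∧ q a = gaussNat p}

lemma card_filter_not_innerCoord_le (d m : ℕ) :
    ((Finset.range m).filter fun α => ¬ InnerCoord d m α).card ≤ 2 * d := by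
  calc _ ≤ (Finset.range d ∪ Finset.Ico (m - d) m).card := by
        refine Finset.card_le_card fun α h => ?_
        rw [Finset.mem_filter, Finset.mem_range, InnerCoord] at h
        simp only [Finset.mem_union, Finset.mem_range, Finset.mem_Ico]
        omega
    _ ≤ d + (m - (m - d)) := by
        refine (Finset.card_union_le _ _).trans ?_
        simp
    _ ≤ 2 * d := by omega

/-- Few vectors of the constellation are close to its boundary. -/
lemma uniformOn_compl_innerConstellation_le (NA M d : ℕ) (hM : 0 < M.sqrt) :
    uniformOn (constellation NA M) (innerConstellation NA M d)ᶜ ≤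
      ENNReal.ofReal (NA * (4 * d / M.sqrt)) := by
  classical
  set m := M.sqrt with hm
  let bad : Finset (ℕ × ℕ) := (Finset.range m ×ˢ Finset.range m).filter
    fun p => ¬ (InnerCoord d m p.1 ∧ InnerCoord d m p.2)
  let B : Finset ℂ := bad.map ⟨gaussNat, gaussNat_injective⟩
  have hbad : bad.card ≤ 4 * d * m := by
    have hsub : bad ⊆ ((Finset.range m).filter fun α => ¬ InnerCoord d m α) ×ˢ Finset.range m ∪
        Finset.range m ×ˢ ((Finset.range m).filter fun α => ¬ InnerCoord d m α) := by
      intro p hp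
      simp only [bad, Finset.mem_filter, Finset.mem_product, Finset.mem_union] at hp ⊢
      tauto
    refine (Finset.card_le_card hsub).trans ((Finset.card_union_le _ _).trans ?_)
    rw [Finset.card_product, Finset.card_product, Finset.card_range]
    have := card_filter_not_innerCoord_le d m
    nlinarith
  have hB : B ⊆ qamFinset M := Finset.map_subset_map.2 (Finset.filter_subset _ _)
  have hne : (qamFinset M).Nonempty := by
    rw [qamFinset, Finset.map_nonempty, Finset.nonempty_product]
    simp [← hm, hM.ne']
  have hcard : (qamFinset M).card = m * m := by simp [qamFinset, ← hm]
  have hsub : constellation NA M ∩ (innerConstellation NA M d)ᶜ ⊆ ⋃ a, {q | q a ∈ B} := by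
    rintro q ⟨hq1, hq2⟩
    simp only [innerConstellation, Set.mem_compl_iff, Set.mem_ofPred_eq, not_forall,
      not_exists] at hq2
    obtain ⟨a, ha⟩ := hq2
    refine Set.mem_iUnion.2 ⟨a, ?_⟩
    have h1 : q a ∈ qamFinset M := by
      rw [← Finset.mem_coe, coe_qamFinset]
      exact hq1 a
    obtain ⟨p, hp, hpq⟩ := Finset.mem_map.1 h1
    refine Finset.mem_map.2 ⟨p, Finset.mem_filter.2 ⟨hp, fun h => ha p ⟨h.1, h.2, hpq.symm⟩⟩, hpq⟩
  calc _ = uniformOn (constellation NA M)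
        (constellation NA M ∩ (innerConstellation NA M d)ᶜ) :=
        (uniformOn_inter_self (finite_constellation NA M)).symm
    _ ≤ ∑ a : Fin NA, uniformOn (constellation NA M) {q | q a ∈ B} :=
        (measure_mono hsub).trans (measure_iUnion_fintype_le _ _)
    _ ≤ ∑ a : Fin NA, ENNReal.ofReal (4 * d / m) := by
        refine Finset.sum_le_sum fun a _ => ?_
        rw [← coe_piFinset_qamFinset, uniformOn_piFinset_eval _ (fun _ => hne) a B hB, hcard,
          Finset.card_map]
        have hm0 : (0 : ℝ) < m := by exact_mod_cast hM
        rw [← ENNReal.ofReal_natCast, ← ENNReal.ofReal_natCast (m * m), ← ENNReal.ofReal_div_of_pos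
          (by push_cast; positivity)]
        refine ENNReal.ofReal_le_ofReal ?_
        rw [div_le_div_iff₀ (by push_cast; positivity) hm0]
        have : (bad.card : ℝ) ≤ 4 * d * m := by exact_mod_cast hbad
        push_cast
        nlinarith
    _ = _ := by
        rw [Finset.sum_const, nsmul_eq_mul, Finset.card_univ, Fintype.card_fin,
          ENNReal.ofReal_mul (by positivity), ENNReal.ofReal_natCast]

end Counting

/-! ### Points of Eve's lattice near a segment -/

section Geometry

/-- One of the four Gaussian units rotates `z` to within `π / 4` of the positive real axis, so that
the real part is at least half the norm. -/
lemma exists_unit_norm_le (z : ℂ) : ∃ s t : ℤ, |s| ≤ 1 ∧ |t| ≤ 1 ∧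
    ‖((s : ℂ) + t * Complex.I)‖ = 1 ∧ ‖z‖ ≤ 2 * (((s : ℂ) + t * Complex.I) * z).re := by
  have hz := Complex.norm_le_abs_re_add_abs_im z
  rcases le_total |z.im| |z.re| with h | h
  · rcases abs_cases z.re with ⟨h1, -⟩ | ⟨h1, -⟩
    · exact ⟨1, 0, by simp, by simp, by simp, by simp; linarith⟩
    · exact ⟨-1, 0, by simp, by simp, by simp, by simp; linarith⟩
  · rcases abs_cases z.im with ⟨h1, -⟩ | ⟨h1, -⟩
    · exact ⟨0, -1, by simp, by simp, by simp, by simp; linarith⟩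
    · exact ⟨0, 1, by simp, by simp, by simp, by simp; linarith⟩

/-- If `g` is not nearly orthogonal to `w`, some Gaussian unit `σ` points `σ • g` so much towards
`w` that `0, σ • g, ..., d • σ • g` stay in every ball of radius `R ≥ ‖w‖` centred on the segment
from `0` to `w`. By convexity only the end points of the segment matter. -/
lemma exists_unit_norm_smul_sub_le {E : Type*} [NormedAddCommGroup E] [InnerProductSpace ℂ E]
    {g w : E} {d : ℕ} {R t : ℝ} (h : d * ‖g‖ ^ 2 ≤ ‖inner ℂ w g‖) (hw : ‖w‖ ≤ R)
    (ht0 : 0 ≤ t) (ht1 : t ≤ 1) : ∃ s r : ℤ, |s| ≤ 1 ∧ |r| ≤ 1 ∧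
      ‖((s : ℂ) + r * Complex.I)‖ = 1 ∧
      ∀ k : ℕ, k ≤ d → ‖((k : ℂ) * ((s : ℂ) + r * Complex.I)) • g - (t : ℂ) • w‖ ≤ R := by
  obtain ⟨s, r, hs, hr, h1, h2⟩ := exists_unit_norm_le (inner ℂ w g)
  refine ⟨s, r, hs, hr, h1, fun k hk => ?_⟩
  set σ : ℂ := (s : ℂ) + r * Complex.I
  set z : E := ((k : ℂ) * σ) • g with hz
  have hkd : (k : ℝ) ≤ d := by exact_mod_cast hk
  have hzn : ‖z‖ = k * ‖g‖ := by rw [hz, norm_smul, norm_mul, h1]; simp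
  have hin : (inner ℂ w z).re = k * (σ * inner ℂ w g).re := by
    rw [hz, inner_smul_right, mul_assoc, ← Complex.ofReal_natCast, Complex.re_ofReal_mul]
  have hz2 : ‖z‖ ^ 2 ≤ 2 * (inner ℂ w z).re := by
    rw [hzn, hin]
    have : k * ‖g‖ ^ 2 ≤ d * ‖g‖ ^ 2 := by gcongr
    nlinarith [Nat.cast_nonneg (α := ℝ) k]
  have hzw : ‖z - w‖ ≤ R := by
    refine le_trans ?_ hw
    have h3 := norm_sub_sq (𝕜 := ℂ) z w
    have h4 : RCLike.re (inner ℂ z w) = (inner ℂ w z).re := inner_re_symm (𝕜 := ℂ) z w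
    rw [h4] at h3
    exact le_of_sq_le_sq (by linarith) (norm_nonneg _)
  have hz0 : ‖z‖ ≤ R := by
    refine le_trans ?_ hw
    have h5 := norm_inner_le_norm (𝕜 := ℂ) w g
    rcases (norm_nonneg g).eq_or_lt with hg | hg
    · rw [hzn, ← hg, mul_zero]
      exact norm_nonneg _
    · rw [hzn]
      have : k * ‖g‖ ^ 2 ≤ d * ‖g‖ ^ 2 := by gcongr
      have : (k * ‖g‖) * ‖g‖ ≤ ‖w‖ * ‖g‖ := by nlinarith
      exact le_of_mul_le_mul_right this hg
  calc ‖z - (t : ℂ) • w‖ = ‖((1 - t : ℝ) : ℂ) • z + (t : ℂ) • (z - w)‖ := by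
        congr 1
        push_cast
        module
    _ ≤ (1 - t) * ‖z‖ + t * ‖z - w‖ := by
        refine (norm_add_le _ _).trans ?_
        rw [norm_smul _ z, norm_smul _ (z - w), Complex.norm_real, Complex.norm_real,
          Real.norm_of_nonneg ht0, Real.norm_of_nonneg (sub_nonneg.2 ht1)]
    _ ≤ (1 - t) * R + t * R := by
        have := sub_nonneg.2 ht1
        gcongr
    _ = R := by ring

end Geometry

/-! ### The key space and the posteriors -/

namespace Wiretap

variable {NA NB NE N : ℕ} {NJ : Fin N → ℕ} {K M : ℕ} {P : ℝ}
  {Ω : Type*} [MeasurableSpace Ω] {μ : Measure Ω}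

lemma norm_jam_le_Rmax (W : Wiretap NA NB NE NJ K M P μ) (i : Fin K) (ω : Ω)
    {x : EuclideanSpace ℂ (PadIndex NB NJ)} (hx : ‖x‖ ^ 2 ≤ P) : ‖W.jam i ω x‖ ≤ W.Rmax i ω := by
  refine le_csSup ?_ ⟨x, hx, rfl⟩
  have hc : Continuous fun x => ‖W.jam i ω x‖ :=
    (LinearMap.continuous_of_finiteDimensional (Matrix.toLpLin 2 2 (W.padChannel i ω))).norm
  refine ((isCompact_closedBall (0 : EuclideanSpace ℂ (PadIndex NB NJ)) √P).bddAbove_image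
    hc.continuousOn).mono (Set.image_mono fun x hx => ?_)
  rw [mem_closedBall_zero_iff]
  exact Real.le_sqrt_of_sq_le hx

lemma finite_finiteLattice (W : Wiretap NA NB NE NJ K M P μ) (i : Fin K) (ω : Ω) :
    (W.finiteLattice i ω).Finite :=
  (finite_constellation NA M).image _

/-- At least `d` lattice points are compatible with Eve's observation as soon as the transmitted
vector is not close to the boundary and some column of Eve's channel is not nearly orthogonal to
the jamming signal of a pad `x` of maximal power in the direction of the actual pad. -/
lemma le_L (W : Wiretap NA NB NE NJ K M P μ) (i : Fin K) (ω : Ω) {d : ℕ} {t : ℝ}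
    {x : EuclideanSpace ℂ (PadIndex NB NJ)} (hx : ‖x‖ ^ 2 ≤ P) (ht0 : 0 ≤ t) (ht1 : t ≤ 1)
    (hv : W.v i ω = (t : ℂ) • x) (hu : W.u i ω ∈ innerConstellation NA M d)
    {a : Fin NA} (ha : (fun e => W.G i ω e a) ∉ nearlyOrthogonal d (W.jam i ω x).ofLp) :
    d ≤ W.L i ω := by
  classical
  set w := W.jam i ω x with hw
  set g : EuclideanSpace ℂ (Fin NE) := WithLp.toLp 2 fun e => W.G i ω e a with hg
  have hlt : d * ‖g‖ ^ 2 < ‖inner ℂ w g‖ := by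
    rw [nearlyOrthogonal, Set.mem_ofPred_eq, not_le] at ha
    rw [EuclideanSpace.norm_sq_eq, PiLp.inner_apply]
    exact ha
  have hg0 : g ≠ 0 := by
    intro h
    simp [h] at hlt
  obtain ⟨s, r, hs, hr, h1, hk⟩ :=
    exists_unit_norm_smul_sub_le hlt.le (W.norm_jam_le_Rmax i ω hx) ht0 ht1
  set σ : ℂ := (s : ℂ) + r * Complex.I with hσ
  have hσ0 : σ ≠ 0 := norm_pos_iff.1 (by rw [h1]; exact one_pos)
  let q : ℕ → Fin NA → ℂ := fun k => W.u i ω + Pi.single a ((k : ℂ) * σ)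
  have hpoint : ∀ k, W.point i ω (q k) = W.point i ω (W.u i ω) + ((k : ℂ) * σ) • g := by
    intro k
    ext e
    simp [point, q, Matrix.mulVec_add, hg, mul_comm]
  have hy : W.y i ω = W.point i ω (W.u i ω) + (t : ℂ) • w := by
    rw [y, hv, hw]
    congr 1
    ext e
    simp [jam, Matrix.mulVec_smul]
  have hq : ∀ k < d, q k ∈ constellation NA M := by
    intro k hkd b
    obtain ⟨p, hp1, hp2, hp⟩ := hu b
    obtain ⟨hp11, hp12⟩ := hp1
    obtain ⟨hp21, hp22⟩ := hp2
    rcases eq_or_ne b a with rfl | hb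
    · have hs' := abs_le.1 hs
      have hr' := abs_le.1 hr
      have e1 : 0 ≤ (p.1 : ℤ) + k * s ∧ (p.1 : ℤ) + k * s < M.sqrt := by
        constructor <;> nlinarith
      have e2 : 0 ≤ (p.2 : ℤ) + k * r ∧ (p.2 : ℤ) + k * r < M.sqrt := by
        constructor <;> nlinarith
      refine ⟨((p.1 : ℤ) + k * s).toNat, ((p.2 : ℤ) + k * r).toNat, by omega, by omega, ?_⟩
      have c1 : ((((p.1 : ℤ) + k * s).toNat : ℕ) : ℂ) = (p.1 : ℂ) + k * s := by
        have := congrArg (Int.cast (R := ℂ)) (Int.toNat_of_nonneg e1.1)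
        push_cast at this
        exact this
      have c2 : ((((p.2 : ℤ) + k * r).toNat : ℕ) : ℂ) = (p.2 : ℂ) + k * r := by
        have := congrArg (Int.cast (R := ℂ)) (Int.toNat_of_nonneg e2.1)
        push_cast at this
        exact this
      rw [c1, c2]
      simp only [q, Pi.add_apply, Pi.single_eq_same, hp, gaussNat, hσ]
      ring
    · refine ⟨p.1, p.2, by omega, by omega, ?_⟩
      simp only [q, Pi.add_apply, Pi.single_eq_of_ne hb, add_zero, hp, gaussNat]
  have hinj : Set.InjOn (fun k => W.point i ω (q k)) (Finset.range d) := by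
    intro k _ l _ hkl
    simp only [hpoint] at hkl
    have := smul_left_injective ℂ hg0 (add_left_cancel hkl)
    exact_mod_cast mul_right_cancel₀ hσ0 this
  calc d = ((fun k => W.point i ω (q k)) '' (Finset.range d : Set ℕ)).ncard := by
        rw [hinj.ncard_image, Set.ncard_coe_finset, Finset.card_range]
    _ ≤ W.L i ω := by
        refine Set.ncard_le_ncard ?_ ((W.finite_finiteLattice i ω).inter_of_right _)
        rintro _ ⟨k, hkd, rfl⟩
        have hkd : k < d := by simpa using hkd
        refine ⟨?_, Set.mem_image_of_mem _ (hq k hkd)⟩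
        rw [Metric.mem_closedBall, dist_eq_norm, hy]
        dsimp only
        rw [hpoint, add_sub_add_left_eq_sub]
        exact hk k hkd.le

/-- When no two inputs give the same lattice point, at least two candidates in each channel use
are enough for ideal secrecy. -/
lemma idealSecrecy_of_injOn (W : Wiretap NA NB NE NJ K M P μ) (ω : Ω)
    (hinj : ∀ i, Set.InjOn (W.point i ω) (constellation NA M)) (hL : ∀ i, 2 ≤ W.L i ω) :
    W.IdealSecrecy ω := by
  classical
  have hsub : ∀ i, W.candidates i ω ⊆ constellation NA M := fun i q hq => hq.1
  have hfin : ∀ i, (W.candidates i ω).Finite := fun i => (finite_constellation NA M).subset (hsub i)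
  have himage : ∀ i, W.point i ω '' W.candidates i ω =
      Metric.closedBall (W.y i ω) (W.Rmax i ω) ∩ W.finiteLattice i ω := by
    intro i
    ext z
    constructor
    · rintro ⟨q, hq, rfl⟩
      exact hq.2
    · rintro ⟨hz1, q, hq, rfl⟩
      exact ⟨q, ⟨hq, hz1, q, hq, rfl⟩, rfl⟩
  let A : Fin K → Finset (Fin NA → ℂ) := fun i => (hfin i).toFinset
  have hA : ∀ i, (A i : Set (Fin NA → ℂ)) = W.candidates i ω := fun i => (hfin i).coe_toFinset
  have hcard : ∀ i, (A i).card = W.L i ω := by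
    intro i
    rw [L, ← himage, ((hinj i).mono (hsub i)).ncard_image, ← hA,
      Set.ncard_coe_finset]
  have hne : ∀ i, (A i).Nonempty := by
    intro i
    rw [← Finset.card_pos, hcard]
    exact two_pos.trans_le (hL i)
  refine fun i => ⟨hL i, fun q hq => ?_⟩
  have hqA : q ∈ A i := by rwa [← Finset.mem_coe, hA]
  have hpost : W.posterior i ω q = (W.L i ω : ENNReal)⁻¹ := by
    rw [posterior, uniformOn, cond_cond_eq_cond_inter' (finite_constellation NA M).measurableSet
      (hfin i).measurableSet (Measure.count_apply_lt_top.2 (finite_constellation NA M)).ne,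
      Set.inter_eq_right.2 (hsub i), ← hA]
    have := uniformOn_apply_finset (s := A i) (t := {q})
    rw [Finset.coe_singleton, Finset.inter_singleton_of_mem hqA, hcard, Finset.card_singleton,
      Nat.cast_one, one_div] at this
    exact this
  refine ⟨?_, hpost⟩
  have hpi : {s : Fin K → Fin NA → ℂ | ∀ k, s k ∈ W.candidates k ω} =
      ↑(Fintype.piFinset A) := by
    ext s
    simp only [Finset.mem_coe, Fintype.mem_piFinset, Set.mem_ofPred_eq]
    exact forall_congr' fun k => by rw [← Finset.mem_coe, hA]
  have hfinS : {s : Fin K → Fin NA → ℂ | ∀ k, s k ∈ constellation NA M}.Finite := by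
    have := Set.Finite.pi' fun _ : Fin K => finite_constellation NA M
    exact this
  have hsubS : {s : Fin K → Fin NA → ℂ | ∀ k, s k ∈ W.candidates k ω} ⊆
      {s | ∀ k, s k ∈ constellation NA M} := fun s hs k => hsub k (hs k)
  rw [hpost, jointPosterior, uniformOn, cond_cond_eq_cond_inter' hfinS.measurableSet
    (hfinS.subset hsubS).measurableSet (Measure.count_apply_lt_top.2 hfinS).ne,
    Set.inter_eq_right.2 hsubS, hpi]
  have := uniformOn_piFinset_eval A hne i {q} (by simpa using hqA)
  simpa [hcard, uniformOn] using this

end Wiretap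

end USK

namespace USK

/-! ### Independence of the sources and the union bound -/

open scoped ENNReal NNReal

section FullPower

variable {ι : Type*} [Fintype ι] [DecidableEq ι]

open scoped Classical in
/-- The pad of maximal power `P` in the direction of the pad `v`, or in the direction of a fixed
basis vector if `v = 0`. -/
noncomputable def fullPower (P : ℝ) (b : ι) (v : EuclideanSpace ℂ ι) : EuclideanSpace ℂ ι :=
  if v = 0 then (√P : ℂ) • EuclideanSpace.single b 1 else ((√P / ‖v‖ : ℝ) : ℂ) • v

lemma norm_fullPower (P : ℝ) (b : ι) (v : EuclideanSpace ℂ ι) : ‖fullPower P b v‖ = √P := by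
  unfold fullPower
  split_ifs with h
  · simp [norm_smul]
  · rw [norm_smul, Complex.norm_real, Real.norm_of_nonneg (by positivity),
      div_mul_cancel₀ _ (norm_ne_zero_iff.2 h)]

lemma smul_fullPower {P : ℝ} (hP : 0 < P) (b : ι) (v : EuclideanSpace ℂ ι) :
    ((‖v‖ / √P : ℝ) : ℂ) • fullPower P b v = v := by
  unfold fullPower
  split_ifs with h
  · simp [h]
  · have h1 : √P ≠ 0 := (Real.sqrt_pos.2 hP).ne'
    have h2 : ‖v‖ ≠ 0 := norm_ne_zero_iff.2 h
    rw [smul_smul, ← Complex.ofReal_mul, div_mul_div_cancel₀ h1, div_self h2, Complex.ofReal_one,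
      one_smul]

lemma measurable_fullPower (P : ℝ) (b : ι) : Measurable (fullPower P b) := by
  refine Measurable.ite (measurableSet_singleton 0) measurable_const ?_
  have : Measurable fun v : EuclideanSpace ℂ ι => ((√P / ‖v‖ : ℝ) : ℂ) := by fun_prop
  exact this.smul measurable_id

end FullPower

/-- The signal emitted by the jammers' antennas, as a function of the precoders and of the pad,
which is first brought to full power. -/
noncomputable def precode {N NB : ℕ} {NJ : Fin N → ℕ} (P : ℝ) (b : PadIndex NB NJ)
    (p : ((j : Fin N) → Fin (NJ j) → Fin (NJ j - NB) → ℂ) × EuclideanSpace ℂ (PadIndex NB NJ)) :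
    JamAntenna NJ → ℂ :=
  (Matrix.blockDiagonal' fun j => Matrix.of (p.1 j)).mulVec (fullPower P b p.2).ofLp

lemma measurable_precode {N NB : ℕ} {NJ : Fin N → ℕ} (P : ℝ) (b : PadIndex NB NJ) :
    Measurable (precode P b) := by
  have hp : Measurable fun v : EuclideanSpace ℂ (PadIndex NB NJ) => (fullPower P b v).ofLp :=
    (WithLp.measurable_ofLp _ _).comp (measurable_fullPower P b)
  refine measurable_pi_lambda _ fun k => ?_
  simp only [precode, Matrix.mulVec, dotProduct]
  refine Finset.measurable_sum _ fun l _ =>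
    Measurable.mul ?_ ((measurable_pi_apply l).comp (hp.comp measurable_snd))
  obtain ⟨k1, k2⟩ := k
  obtain ⟨l1, l2⟩ := l
  by_cases h : k1 = l1
  · subst h
    simp only [Matrix.blockDiagonal'_apply_eq, Matrix.of_apply]
    fun_prop
  · simp only [Matrix.blockDiagonal'_apply_ne _ _ _ h]
    exact measurable_const

lemma Phi_pos (NA NE : ℕ) : 0 < Phi NA NE := by
  unfold Phi
  have := Nat.factorial_pos (NE - NA)
  have := Nat.factorial_pos NE
  positivity

lemma kappa_pos {NE d : ℕ} (hd : 0 < d) : 0 < kappa NE d := by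
  unfold kappa
  positivity

namespace Wiretap

variable {NA NB NE N : ℕ} {NJ : Fin N → ℕ} {K M : ℕ} {P : ℝ}
  {Ω : Type*} [MeasurableSpace Ω] {μ : Measure Ω}

/-- The signal that the jammers' antennas would emit for the pad at full power. -/
noncomputable def emitted (W : Wiretap NA NB NE NJ K M P μ) (b : PadIndex NB NJ) (i : Fin K)
    (ω : Ω) : JamAntenna NJ → ℂ :=
  precode P b (fun j => W.Z i j ω, W.v i ω)

lemma jam_fullPower (W : Wiretap NA NB NE NJ K M P μ) (b : PadIndex NB NJ) (i : Fin K) (ω : Ω) :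
    (W.jam i ω (fullPower P b (W.v i ω))).ofLp =
      fun e => ∑ j, W.HJE i ω e j * W.emitted b i ω j := by
  simp only [jam, padChannel, ← Matrix.mulVec_mulVec]
  rfl

/-- The precoders are isometries, so they preserve the power. -/
lemma sum_norm_sq_emitted (W : Wiretap NA NB NE NJ K M P μ) (hP : 0 ≤ P) (b : PadIndex NB NJ)
    (i : Fin K) : ∀ᵐ ω ∂μ, ∑ j, ‖W.emitted b i ω j‖ ^ 2 = P := by
  filter_upwards [ae_all_iff.2 (W.orthonormal_Z i)] with ω hω
  set B := Matrix.blockDiagonal' fun j => Matrix.of (W.Z i j ω) with hB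
  have h1 : B.conjTranspose * B = 1 := by
    rw [hB, Matrix.blockDiagonal'_conjTranspose, ← Matrix.blockDiagonal'_mul]
    simp only [hω]
    exact Matrix.blockDiagonal'_one
  have h2 : ∀ {ι : Type} [Fintype ι] (z : ι → ℂ), ((∑ j, ‖z j‖ ^ 2 : ℝ) : ℂ) = star z ⬝ᵥ z := by
    intro ι _ z
    simp only [dotProduct, Pi.star_apply, RCLike.star_def, RCLike.conj_mul]
    push_cast
    rfl
  have h3 : ∑ j, ‖(fullPower P b (W.v i ω)).ofLp j‖ ^ 2 = P := by
    rw [← EuclideanSpace.norm_sq_eq, norm_fullPower, Real.sq_sqrt hP]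
  have h4 : ((∑ j, ‖W.emitted b i ω j‖ ^ 2 : ℝ) : ℂ) = (P : ℂ) := by
    rw [h2, emitted, precode, ← hB, Matrix.star_mulVec, Matrix.dotProduct_mulVec,
      Matrix.vecMul_vecMul, h1, Matrix.vecMul_one, ← h2, h3]
  exact_mod_cast h4

/-- The information carried by each of the independent sources. -/
@[reducible] noncomputable def sourceSpace (W : Wiretap NA NB NE NJ K M P μ) :
    Fin K × Source N → MeasurableSpace Ω
  | (i, .message) => MeasurableSpace.comap (W.u i) inferInstance
  | (i, .aliceEve) => MeasurableSpace.comap (W.G i) inferInstance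
  | (i, .jamEve) => MeasurableSpace.comap (W.HJE i) inferInstance
  | (i, .jamBob j) => MeasurableSpace.comap (fun ω => (W.HJB i j ω, W.Z i j ω)) inferInstance
  | (i, .pad) => MeasurableSpace.comap (W.v i) inferInstance

lemma iIndep_sourceSpace (W : Wiretap NA NB NE NJ K M P μ) : iIndep W.sourceSpace μ :=
  W.indep

lemma sourceSpace_le (W : Wiretap NA NB NE NJ K M P μ) (s : Fin K × Source N) :
    W.sourceSpace s ≤ ‹MeasurableSpace Ω› := by
  rcases s with ⟨i, _ | _ | _ | j | _⟩
  · exact (W.measurable_u i).comap_le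
  · exact (W.measurable_G i).comap_le
  · exact (W.measurable_HJE i).comap_le
  · exact ((W.measurable_HJB i j).prodMk (W.measurable_Z i j)).comap_le
  · exact (W.measurable_v i).comap_le

lemma measurable_emitted (W : Wiretap NA NB NE NJ K M P μ) (b : PadIndex NB NJ) (i : Fin K) :
    Measurable (W.emitted b i) :=
  Measurable.comp (g := precode P b) (f := fun ω => (fun j => W.Z i j ω, W.v i ω))
    (measurable_precode P b) ((measurable_pi_lambda _ (W.measurable_Z i)).prodMk (W.measurable_v i))

/-- The joint law of the two channels to Eve and of the emitted signal. -/
lemma map_channels_emitted [IsProbabilityMeasure μ] (W : Wiretap NA NB NE NJ K M P μ)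
    (b : PadIndex NB NJ) (i : Fin K) :
    μ.map (fun ω => ((W.G i ω, W.HJE i ω), W.emitted b i ω)) =
      ((gaussianMatrix (Fin NE) (Fin NA)).prod (gaussianMatrix (Fin NE) (JamAntenna NJ))).prod
        (μ.map (W.emitted b i)) := by
  have hle : ∀ {S : Set (Fin K × Source N)} {s}, s ∈ S →
      W.sourceSpace s ≤ ⨆ s ∈ S, W.sourceSpace s :=
    fun hs => le_biSup W.sourceSpace hs
  have hGH : IndepFun (W.G i) (W.HJE i) μ :=
    W.iIndep_sourceSpace.indep (i := (i, .aliceEve)) (j := (i, .jamEve)) (by simp)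
  let S : Set (Fin K × Source N) := {(i, .aliceEve), (i, .jamEve)}
  have hGHZ : IndepFun (fun ω => (W.G i ω, W.HJE i ω))
      (fun ω => (fun j => W.Z i j ω, W.v i ω)) μ := by
    have h := indep_iSup_of_disjoint W.sourceSpace_le W.iIndep_sourceSpace
      (disjoint_compl_right (a := S))
    refine indep_of_indep_of_le_right (indep_of_indep_of_le_left h ?_) ?_
    · refine Measurable.comap_le (Measurable.prodMk ?_ ?_)
      · exact (comap_measurable (W.G i)).mono (hle (s := (i, .aliceEve)) (by simp [S])) le_rfl
      · exact (comap_measurable (W.HJE i)).mono (hle (s := (i, .jamEve)) (by simp [S])) le_rfl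
    · refine Measurable.comap_le (Measurable.prodMk ?_ ?_)
      · refine @measurable_pi_lambda _ _ _ (_) _ _ fun j => ?_
        have hm := (comap_measurable fun ω => (W.HJB i j ω, W.Z i j ω)).mono
          (hle (S := Sᶜ) (s := (i, .jamBob j)) (by simp [S])) le_rfl
        exact measurable_snd.comp hm
      · exact (comap_measurable (W.v i)).mono (hle (s := (i, .pad)) (by simp [S])) le_rfl
  have hGHe : IndepFun (fun ω => (W.G i ω, W.HJE i ω)) (W.emitted b i) μ :=
    IndepFun.comp (φ := id) (ψ := precode P b) hGHZ measurable_id (measurable_precode P b)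
  have hG := W.measurable_G i
  have hH := W.measurable_HJE i
  rw [(indepFun_iff_map_prod_eq_prod_map_map (hG.prodMk hH).aemeasurable
    (W.measurable_emitted b i).aemeasurable).1 hGHe,
    (indepFun_iff_map_prod_eq_prod_map_map hG.aemeasurable hH.aemeasurable).1 hGH,
    W.law_G, W.law_HJE]

/-- The event that all the columns of Eve's channel are nearly orthogonal to the jamming signal
at full power. -/
def jamOrthogonal (W : Wiretap NA NB NE NJ K M P μ) (d : ℕ) (b : PadIndex NB NJ) (i : Fin K) :
    Set Ω :=
  {ω | ∀ a, (fun e => W.G i ω e a) ∈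
    nearlyOrthogonal d (W.jam i ω (fullPower P b (W.v i ω))).ofLp}

/-- The constant depends neither on the law of the pad nor on the null spaces of the channels to
Bob: the emitted signal enters only through its norm `√P`. -/
lemma exists_jamOrthogonal_le (NA NE : ℕ) (d k : ℕ) (hkE : k ≤ NE) (hkA : k ≤ NA) :
    ∃ C : ℝ, 0 ≤ C ∧ ∀ {NB N K M : ℕ} {NJ : Fin N → ℕ} {P : ℝ} {Ω : Type*} [MeasurableSpace Ω]
      {μ : Measure Ω} [IsProbabilityMeasure μ] (W : Wiretap NA NB NE NJ K M P μ)
      (b : PadIndex NB NJ) (i : Fin K), 0 < P →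
      μ (W.jamOrthogonal d b i) ≤ ENNReal.ofReal ((C * √((∑ j, NJ j : ℕ) / P)) ^ k) := by
  obtain ⟨C, hC⟩ := exists_forall_nearlyOrthogonal_le (Fin NE) (Fin NA) d k (by simpa) (by simpa)
  refine ⟨C, C.2, fun {NB N K M NJ P Ω} _ {μ} _ W b i hP => ?_⟩
  set T : Set (((Fin NE → Fin NA → ℂ) × (Fin NE → JamAntenna NJ → ℂ)) × (JamAntenna NJ → ℂ)) :=
    {p | ∀ a, (fun e => p.1.1 e a) ∈ nearlyOrthogonal d fun e => ∑ j, p.1.2 e j * p.2 j} with hT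
  have hTm : MeasurableSet T := by
    simp only [hT, nearlyOrthogonal, Set.mem_ofPred_eq, Set.ofPred_forall]
    exact MeasurableSet.iInter fun a => measurableSet_le (by fun_prop) (by fun_prop)
  have hpre : W.jamOrthogonal d b i =
      (fun ω => ((W.G i ω, W.HJE i ω), W.emitted b i ω)) ⁻¹' T := by
    ext ω
    simp only [jamOrthogonal, jam_fullPower]
    rfl
  have hprob : IsProbabilityMeasure (μ.map (W.emitted b i)) :=
    Measure.isProbabilityMeasure_map (W.measurable_emitted b i).aemeasurable
  have hae : ∀ᵐ x ∂μ.map (W.emitted b i), ∑ j, ‖x j‖ ^ 2 = P :=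
    (ae_map_iff (W.measurable_emitted b i).aemeasurable
      (measurableSet_eq_fun (by fun_prop) (by fun_prop))).2 (W.sum_norm_sq_emitted hP.le b i)
  rw [hpre, ← Measure.map_apply (((W.measurable_G i).prodMk (W.measurable_HJE i)).prodMk
    (W.measurable_emitted b i)) hTm, map_channels_emitted, Measure.prod_apply_symm hTm]
  calc _ ≤ ∫⁻ _, ENNReal.ofReal ((C * √((∑ j, NJ j : ℕ) / P)) ^ k) ∂μ.map (W.emitted b i) := by
        refine lintegral_mono_ae ?_
        filter_upwards [hae] with x hx
        -- One of the antennas carries at least the average power.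
        obtain ⟨j, hj⟩ : ∃ j, P / (∑ j, NJ j : ℕ) ≤ ‖x j‖ ^ 2 := by
          by_contra! hlt
          rcases isEmpty_or_nonempty (JamAntenna NJ) with he | he
          · rw [Finset.univ_eq_empty, Finset.sum_empty] at hx
            exact hP.ne hx
          have h1 := Finset.sum_lt_sum_of_nonempty Finset.univ_nonempty fun j _ => hlt j
          have h2 : Fintype.card (JamAntenna NJ) = ∑ j, NJ j := by simp [JamAntenna]
          have h3 : 0 < ∑ j, NJ j := h2 ▸ Fintype.card_pos
          rw [hx, Finset.sum_const, Finset.card_univ, h2, nsmul_eq_mul,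
            mul_div_cancel₀ _ (by exact_mod_cast h3.ne')] at h1
          exact lt_irrefl _ h1
        have hn : 0 < ∑ j, NJ j := by
          obtain ⟨j1, j2⟩ := j
          exact (j2.pos).trans_le (Finset.single_le_sum (f := NJ) (fun _ _ => Nat.zero_le _)
            (Finset.mem_univ j1))
        have hn' : (0 : ℝ) < (∑ j, NJ j : ℕ) := by exact_mod_cast hn
        have hj0 : 0 < ‖x j‖ := by
          have : 0 < ‖x j‖ ^ 2 := lt_of_lt_of_le (by positivity) hj
          exact (norm_nonneg _).lt_of_ne' fun h => by simp [h] at this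
        refine (hC (JamAntenna NJ) x j (norm_pos_iff.1 hj0)).trans ?_
        rw [ENNReal.ofReal_pow (by positivity), ENNReal.ofReal_mul C.coe_nonneg,
          ENNReal.ofReal_coe_nnreal]
        gcongr
        rw [← ofReal_norm, ← ENNReal.ofReal_inv_of_pos hj0]
        refine ENNReal.ofReal_le_ofReal (Real.le_sqrt_of_sq_le ?_)
        rw [inv_pow, inv_le_comm₀ (by positivity) (by positivity), inv_div]
        exact hj
    _ = _ := by simp

/-- The transmitted vector is rarely close to the boundary of the constellation. -/
lemma measure_u_notMem_innerConstellation_le (W : Wiretap NA NB NE NJ K M P μ) (d : ℕ) (i : Fin K)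
    (hM : 0 < M.sqrt) : μ {ω | W.u i ω ∉ innerConstellation NA M d} ≤
      ENNReal.ofReal (NA * (4 * d / M.sqrt)) := by
  refine le_trans ?_ (uniformOn_compl_innerConstellation_le NA M d hM)
  rw [← W.law_u i]
  exact Measure.le_map_apply (W.measurable_u i).aemeasurable _

/-- Almost surely, distinct inputs give distinct points of Eve's lattice. -/
lemma ae_injOn_point (W : Wiretap NA NB NE NJ K M P μ) (hNE : 0 < NE) (i : Fin K) :
    ∀ᵐ ω ∂μ, Set.InjOn (W.point i ω) (constellation NA M) := by
  have : Nonempty (Fin NE) := ⟨⟨0, hNE⟩⟩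
  have hc := (finite_constellation NA M).countable
  have h : ∀ᵐ G ∂gaussianMatrix (Fin NE) (Fin NA), ∀ q ∈ constellation NA M,
      ∀ q' ∈ constellation NA M, q - q' ≠ 0 → (Matrix.of G).mulVec (q - q') ≠ 0 := by
    refine (ae_ball_iff hc).2 fun q _ => (ae_ball_iff hc).2 fun q' _ => ?_
    by_cases hq : q - q' = 0
    · simp [hq]
    · filter_upwards [ae_gaussianMatrix_mulVec_ne_zero hq] with G hG _ using hG
  rw [← W.law_G i] at h
  filter_upwards [ae_of_ae_map (W.measurable_G i).aemeasurable h] with ω hω q hq q' hq' heq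
  by_contra hne
  refine hω q hq q' hq' (sub_ne_zero.2 hne) ?_
  rw [Matrix.mulVec_sub, sub_eq_zero]
  exact congrArg WithLp.ofLp heq

/-- The key space is large and secrecy is ideal, except on the events that some transmitted vector
is close to the boundary or that some jamming signal is nearly orthogonal to Eve's channel. -/
lemma measure_compl_secrecy_le [IsProbabilityMeasure μ] (W : Wiretap NA NB NE NJ K M P μ)
    (hNE : 0 < NE) (hP : 0 < P) {d : ℕ} (hd : 2 ≤ d) (b : PadIndex NB NJ) {p q : ℝ≥0∞}
    (hp : ∀ i, μ (W.jamOrthogonal d b i) ≤ p)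
    (hq : ∀ i, μ {ω | W.u i ω ∉ innerConstellation NA M d} ≤ q) :
    μ {ω | (∀ i, d ≤ W.L i ω) ∧ W.IdealSecrecy ω}ᶜ ≤ K * (p + q) := by
  have hinc : ({ω | (∀ i, d ≤ W.L i ω) ∧ W.IdealSecrecy ω}ᶜ : Set Ω) ≤ᵐ[μ]
      (⋃ i, (W.jamOrthogonal d b i ∪ {ω | W.u i ω ∉ innerConstellation NA M d}) : Set Ω) := by
    filter_upwards [ae_all_iff.2 W.power_v, ae_all_iff.2 (W.ae_injOn_point hNE)] with ω hv hinj hω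
    by_contra hbad
    refine hω ?_
    have hbad' : ∀ i, ω ∉ W.jamOrthogonal d b i ∧ W.u i ω ∈ innerConstellation NA M d := by
      intro i
      constructor
      · exact fun h => hbad (Set.mem_iUnion.2 ⟨i, Or.inl h⟩)
      · by_contra h
        exact hbad (Set.mem_iUnion.2 ⟨i, Or.inr h⟩)
    have hL : ∀ i, d ≤ W.L i ω := by
      intro i
      obtain ⟨h1, h2⟩ := hbad' i
      simp only [jamOrthogonal, Set.mem_ofPred_eq, not_forall] at h1
      obtain ⟨a, ha⟩ := h1
      refine W.le_L i ω (t := ‖W.v i ω‖ / √P) ?_ (by positivity) ?_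
        (smul_fullPower hP b (W.v i ω)).symm h2 ha
      · rw [norm_fullPower, Real.sq_sqrt hP.le]
      · exact div_le_one_of_le₀ (Real.le_sqrt_of_sq_le (hv i)) (Real.sqrt_nonneg _)
    exact ⟨hL, W.idealSecrecy_of_injOn ω hinj fun i => hd.trans (hL i)⟩
  calc _ ≤ ∑ i : Fin K, (p + q) := by
        refine (measure_mono_ae hinc).trans ((measure_iUnion_fintype_le _ _).trans ?_)
        exact Finset.sum_le_sum fun i _ => (measure_union_le _ _).trans (add_le_add (hp i) (hq i))
    _ = K * (p + q) := by simp [mul_add]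

end Wiretap

/-- The jamming power is tuned so that `(1 / √P) ^ Nmin = O(ε)`. -/
lemma sqrt_div_jamPower_pow {NA NE d : ℕ} (hNA : 1 ≤ NA) (hd : 0 < d) {n ε : ℝ} (hn : 0 ≤ n)
    (hε : 0 < ε) : √(n / jamPower NA NE d ε) ^ Nmin NA NE =
      √(n / (kappa NE d ^ 2 / Phi NA NE ^ (2 * (NA : ℝ) / (NE : ℝ)))) ^ Nmin NA NE * ε := by
  have hκ : 0 < kappa NE d := kappa_pos hd
  have hΦ := Phi_pos NA NE
  have hk : (Nmin NA NE : ℝ) ≠ 0 := by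
    have : 0 < Nmin NA NE := by unfold Nmin; omega
    exact_mod_cast this.ne'
  set c := kappa NE d ^ 2 / Phi NA NE ^ (2 * (NA : ℝ) / (NE : ℝ)) with hc
  have hc0 : 0 < c := by positivity
  have h1 : n / jamPower NA NE d ε = n / c * (ε ^ (1 / (Nmin NA NE : ℝ))) ^ 2 := by
    have h2 : (ε ^ (1 / (Nmin NA NE : ℝ))) ^ 2 = (ε ^ (-2 / (Nmin NA NE : ℝ)))⁻¹ := by
      rw [← Real.rpow_neg hε.le, ← Real.rpow_natCast, ← Real.rpow_mul hε.le]
      congr 1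
      push_cast
      ring
    rw [h2, jamPower, mul_div_assoc, ← hc]
    field_simp
  rw [h1, Real.sqrt_mul (by positivity), Real.sqrt_sq (by positivity), mul_pow,
    ← Real.rpow_natCast (ε ^ _), ← Real.rpow_mul hε.le, one_div_mul_cancel hk, Real.rpow_one]

end USK

theorem theorem1 (NA NB NE N : ℕ) (NJ : Fin N → ℕ)
    (hNA : 1 ≤ NA) (hAB : NA ≤ NB) (hAE : NA ≤ NE)
    (hBJ : ∀ j, NB < NJ j) (hEJ : NE < ∑ j, NJ j)
    (K d : ℕ) (hd : 2 ≤ d) :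
    ∃ C : ℝ, ∀ ε : ℝ, 0 < ε → ε < 1 →
      ∀ M : ℕ, IsSquare M →
        ε ^ (-3 - 2 / (USK.Nmin NA NE : ℝ)) * USK.kappa NE d ^ 2 ≤ (M : ℝ) →
        ∀ (Ω : Type*) [MeasurableSpace Ω] (μ : MeasureTheory.Measure Ω)
          [MeasureTheory.IsProbabilityMeasure μ]
          (W : USK.Wiretap NA NB NE NJ K M (USK.jamPower NA NE d ε) μ),
          W.Pout d ≤ C * ε ∧ 1 - C * ε ≤ μ.real {ω | W.IdealSecrecy ω} := by
  have hk1 : USK.Nmin NA NE ≤ NA := min_le_right _ _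
  have hκ : 0 < USK.kappa NE d := USK.kappa_pos (by omega)
  have hΦ := USK.Phi_pos NA NE
  obtain ⟨C, hC0, hC⟩ := USK.Wiretap.exists_jamOrthogonal_le NA NE d (USK.Nmin NA NE)
    (hk1.trans hAE) hk1
  set D := (C * √((∑ j, NJ j : ℕ) / (USK.kappa NE d ^ 2 /
    USK.Phi NA NE ^ (2 * (NA : ℝ) / (NE : ℝ))))) ^ USK.Nmin NA NE with hD
  have hD0 : 0 ≤ D := by positivity
  refine ⟨K * (D + NA * (4 * d / USK.kappa NE d)), fun ε hε hε1 M hM hMε Ω _ μ _ W => ?_⟩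
  have hP : 0 < USK.jamPower NA NE d ε := by unfold USK.jamPower; positivity
  -- The pad has at least one coordinate, as there is a jammer with more antennas than Bob.
  obtain ⟨j⟩ : Nonempty (Fin N) := by
    by_contra h
    rw [not_nonempty_iff] at h
    simp at hEJ
  let b : USK.PadIndex NB NJ := ⟨j, ⟨0, Nat.sub_pos_of_lt (hBJ j)⟩⟩
  -- The side of the constellation is at least `κ / ε`.
  have hside : USK.kappa NE d / ε ≤ M.sqrt := by
    obtain ⟨m, rfl⟩ := hM
    rw [Nat.sqrt_eq]
    refine le_of_sq_le_sq (a := USK.kappa NE d / ε) ?_ (Nat.cast_nonneg m)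
    calc (USK.kappa NE d / ε) ^ 2 = ε ^ (-2 : ℝ) * USK.kappa NE d ^ 2 := by
          rw [Real.rpow_neg hε.le, Real.rpow_two, div_pow, div_eq_inv_mul]
      _ ≤ ε ^ (-3 - 2 / (USK.Nmin NA NE : ℝ)) * USK.kappa NE d ^ 2 := by
          refine mul_le_mul_of_nonneg_right ?_ (by positivity)
          refine Real.rpow_le_rpow_of_exponent_ge hε hε1.le ?_
          have : (0 : ℝ) ≤ 2 / (USK.Nmin NA NE : ℝ) := by positivity
          linarith
      _ ≤ (m : ℝ) ^ 2 := by
          rw [sq (m : ℝ)]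
          exact_mod_cast hMε
  have hside0 : (0 : ℝ) < M.sqrt := lt_of_lt_of_le (by positivity) hside
  have hbad := W.measure_compl_secrecy_le (by omega) hP hd b
    (fun i => hC W b i hP)
    (fun i => W.measure_u_notMem_innerConstellation_le d i (by exact_mod_cast hside0))
  have hbound : (K : ENNReal) * (ENNReal.ofReal ((C * √((∑ j, NJ j : ℕ) /
      USK.jamPower NA NE d ε)) ^ USK.Nmin NA NE) + ENNReal.ofReal (NA * (4 * d / M.sqrt))) ≤
      ENNReal.ofReal (K * (D + NA * (4 * d / USK.kappa NE d)) * ε) := by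
    rw [← ENNReal.ofReal_natCast K, ← ENNReal.ofReal_add (by positivity) (by positivity),
      ← ENNReal.ofReal_mul (by positivity)]
    refine ENNReal.ofReal_le_ofReal ?_
    rw [mul_assoc, add_mul]
    gcongr (K : ℝ) * (?_ + ?_)
    · rw [mul_pow, USK.sqrt_div_jamPower_pow hNA (by omega) (Nat.cast_nonneg _) hε, ← mul_assoc,
        ← mul_pow]
    · rw [mul_assoc]
      refine mul_le_mul_of_nonneg_left ?_ (Nat.cast_nonneg _)
      rw [div_mul_eq_mul_div, div_le_div_iff₀ hside0 hκ]
      rw [div_le_iff₀ hε] at hside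
      nlinarith [Nat.cast_nonneg (α := ℝ) d]
  set G := {ω | (∀ i, d ≤ W.L i ω) ∧ W.IdealSecrecy ω} with hG
  -- The events need not be measurable: only subadditivity of the outer measure is used.
  have hlarge : ∀ A : Set Ω, G ⊆ A →
      1 - K * (D + NA * (4 * d / USK.kappa NE d)) * ε ≤ μ.real A := by
    intro A hGA
    have h1 : (1 : ENNReal) ≤ μ A + ENNReal.ofReal
        (K * (D + NA * (4 * d / USK.kappa NE d)) * ε) := by
      calc (1 : ENNReal) = μ Set.univ := measure_univ.symm
        _ ≤ μ (A ∪ Gᶜ) := measure_mono fun ω _ => by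
            by_cases h : ω ∈ G
            · exact Or.inl (hGA h)
            · exact Or.inr h
        _ ≤ _ := (measure_union_le _ _).trans (add_le_add_right (hbad.trans hbound) _)
    rw [← ofReal_measureReal, ← ENNReal.ofReal_add (by positivity) (by positivity),
      ENNReal.one_le_ofReal] at h1
    linarith
  refine ⟨?_, hlarge _ fun ω hω => hω.2⟩
  have := hlarge {ω | ∀ i, d ≤ W.L i ω} fun ω hω => hω.1
  rw [USK.Wiretap.Pout]
  linarith
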